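/- Let $u_0,u_1:\mathbb R^n\to\mathbb R$ be functions such that $u_0$ has generalized (weak) partial derivatives of all integer orders $k\le \frac n2+3$ that are square integrable on each bounded set, and $u_1$ has generalized partial derivatives of all integer orders $k\le\frac n2+2$ that are square integrable on each bounded set. (Order $k=0$ is included, i.e. $u_0$ and $u_1$ themselves are square integrable on bounded sets. A function $g$ that is square integrable on bounded sets is the generalized derivative $\partial_{i_1}\cdots\partial_{i_k}f$ if $\int f\,\partial_{i_1}\cdots\partial_{i_k}\varphi\,dx=(-1)^k\int g\,\varphi\,dx$ for all $\varphi\in C_c^\infty(\mathbb R^n)$.) Then there is a function $u=u(x,t)$, twice continuously differentiable on all of $\mathbb R^n\times\mathbb R$, such that $$\Delta u-\frac{\partial^2u}{\partial t^2}=0\quad\text{on }\mathbb R^n\times\mathbb R,\qquad u|_{t=0}=u_0,\qquad \frac{\partial u}{\partial t}\Big|_{t=0}=u_1,$$ where $\Delta$ is the Laplacian in $x\in\mathbb R^n$ and the two initial conditions hold almost everywhere on $\mathbb R^n$ (the functions $u_0,u_1$ being determined only up to null sets). -/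

import Mathlib

open MeasureTheory InnerProductSpace Laplacian
open scoped ContDiff

noncomputable section

/-- The classical iterated partial derivative `∂_{i 0} ∂_{i 1} ⋯ ∂_{i (k-1)} φ` of order `k` of a
function on `ℝⁿ`. As `i` ranges over all maps `Fin k → Fin n`, this gives all partial derivatives of
order exactly `k`; for `k = 0` it is `φ` itself. -/
def partialDerivative {n k : ℕ} (i : Fin k → Fin n) (φ : EuclideanSpace ℝ (Fin n) → ℝ) :
    EuclideanSpace ℝ (Fin n) → ℝ :=
  fun x => iteratedFDeriv ℝ k φ x (fun j => EuclideanSpace.single (i j) (1 : ℝ))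

/-- `g` is the generalized (weak) partial derivative `∂_{i 0} ⋯ ∂_{i (k-1)} f` on `ℝⁿ`: integration
by parts holds against every smooth compactly supported test function. This is meant for locally
integrable `f` and `g`. -/
def IsGeneralizedDerivative {n k : ℕ} (i : Fin k → Fin n)
    (f g : EuclideanSpace ℝ (Fin n) → ℝ) : Prop :=
  ∀ φ : EuclideanSpace ℝ (Fin n) → ℝ, ContDiff ℝ ∞ φ → HasCompactSupport φ →
    ∫ x, f x * partialDerivative i φ x = (-1 : ℝ) ^ k * ∫ x, g x * φ x

/-- `f` is (measurable and) square integrable on each bounded subset of `ℝⁿ`. -/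
def SquareIntegrableOnBounded {n : ℕ} (f : EuclideanSpace ℝ (Fin n) → ℝ) : Prop :=
  ∀ B : Set (EuclideanSpace ℝ (Fin n)), Bornology.IsBounded B → MemLp f 2 (volume.restrict B)

/-- `f` has generalized derivatives of all orders up to `s` that are square integrable on each
bounded set. The order `k` of a derivative is a natural number, and all `k ≤ s` are meant,
including `k = 0`, that is, `f` itself. -/
def HasSquareIntegrableDerivativesUpTo {n : ℕ} (s : ℝ) (f : EuclideanSpace ℝ (Fin n) → ℝ) : Prop :=
  SquareIntegrableOnBounded f ∧
    ∀ k : ℕ, (k : ℝ) ≤ s → ∀ i : Fin k → Fin n,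
      ∃ g : EuclideanSpace ℝ (Fin n) → ℝ,
        SquareIntegrableOnBounded g ∧ IsGeneralizedDerivative i f g

/-- The wave operator `□u = Δu - ∂²u/∂t²` on functions of `(x, t) ∈ ℝⁿ × ℝ`, where `Δ` is the
Laplacian in the space variable `x`. -/
def waveOperator {n : ℕ} (u : EuclideanSpace ℝ (Fin n) × ℝ → ℝ) :
    EuclideanSpace ℝ (Fin n) × ℝ → ℝ :=
  fun p => (Δ (fun y => u (y, p.2))) p.1 - iteratedDeriv 2 (fun s => u (p.1, s)) p.2

end

/-!
Solutions of the wave equation have finite speed of propagation: the energy in the truncated cone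
over a ball of radius `R` cannot increase, so a `C²` solution is determined on `‖x‖ + |t| < R` by
its data on that ball. It therefore suffices to solve, for each `R`, with data that are correct only
on the ball of radius `R`: the solutions for different radii agree where they overlap.

For a fixed ball, multiply the data by a cutoff and superpose the elementary solutions
`e^{2πi⟪ξ, x⟫} (a cos(2π‖ξ‖t) + b sin(2π‖ξ‖t) / (2π‖ξ‖))`, with `a` and `b` the Fourier transforms
of the truncated data. Square integrable derivatives of order `k` make `(1 + 2π‖ξ‖)^k` times these
transforms square integrable. Since `(1 + 2π‖ξ‖)^{-l}` is square integrable for `l > n / 2`, the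
Cauchy–Schwarz inequality makes the superposition converge absolutely together with its derivatives
of order `k - l`.
-/

open Topology Set Filter FourierTransform

variable {n : ℕ}

local notation "𝔼" => EuclideanSpace ℝ (Fin n)

/-- The trace of a bilinear form on `ℝⁿ × ℝ` with respect to the metric of signature
`(+, …, +, -)`, so that `waveOperator u` is the trace of the second derivative of `u`. -/
noncomputable def minkowskiTrace (n : ℕ) :
    ((EuclideanSpace ℝ (Fin n) × ℝ) [×2]→L[ℝ] ℝ) →L[ℝ] ℝ :=
  ∑ j, ContinuousMultilinearMap.apply ℝ (fun _ : Fin 2 => EuclideanSpace ℝ (Fin n) × ℝ) ℝ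
      (fun _ => (EuclideanSpace.single j 1, 0)) -
    ContinuousMultilinearMap.apply ℝ (fun _ : Fin 2 => EuclideanSpace ℝ (Fin n) × ℝ) ℝ
      (fun _ => (0, 1))

theorem minkowskiTrace_apply (A : (𝔼 × ℝ) [×2]→L[ℝ] ℝ) :
    minkowskiTrace n A = ∑ j, A (fun _ => (EuclideanSpace.single j 1, 0)) - A fun _ => (0, 1) := by
  simp [minkowskiTrace]

theorem iteratedFDeriv_comp_const_add_clm {E F G : Type*} [NormedAddCommGroup E]
    [NormedSpace ℝ E] [NormedAddCommGroup F] [NormedSpace ℝ F] [NormedAddCommGroup G]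
    [NormedSpace ℝ G] {k : ℕ} {u : F → G} (hu : ContDiff ℝ k u) (a : F) (L : E →L[ℝ] F) (x : E) :
    iteratedFDeriv ℝ k (fun y => u (a + L y)) x =
      (iteratedFDeriv ℝ k u (a + L x)).compContinuousLinearMap fun _ => L := by
  have shifted : ContDiff ℝ k fun z => u (a + z) := hu.comp (contDiff_const.add contDiff_id)
  simpa only [iteratedFDeriv_comp_add_left, Function.comp_def] using
    L.iteratedFDeriv_comp_right (i := k) shifted x le_rfl

theorem waveOperator_eq_minkowskiTrace {u : 𝔼 × ℝ → ℝ} (hu : ContDiff ℝ 2 u) (p : 𝔼 × ℝ) :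
    waveOperator u p = minkowskiTrace n (iteratedFDeriv ℝ 2 u p) := by
  obtain ⟨x, t⟩ := p
  have space : (Δ fun y => u (y, t)) x =
      ∑ j, iteratedFDeriv ℝ 2 u (x, t) fun _ => (EuclideanSpace.single j 1, 0) := by
    have slice := iteratedFDeriv_comp_const_add_clm (k := 2) hu (0, t)
      (ContinuousLinearMap.inl ℝ 𝔼 ℝ) x
    simp only [ContinuousLinearMap.inl_apply, Prod.mk_add_mk, zero_add, add_zero] at slice
    rw [laplacian_eq_iteratedFDeriv_orthonormalBasis _ (EuclideanSpace.basisFun (Fin n) ℝ)]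
    simp only [slice, ContinuousMultilinearMap.compContinuousLinearMap_apply]
    refine Finset.sum_congr rfl fun j _ => congrArg _ (funext fun i => ?_)
    fin_cases i <;> simp
  have time : iteratedDeriv 2 (fun s => u (x, s)) t =
      iteratedFDeriv ℝ 2 u (x, t) fun _ => (0, 1) := by
    have slice := iteratedFDeriv_comp_const_add_clm (k := 2) hu (x, 0)
      (ContinuousLinearMap.inr ℝ 𝔼 ℝ) t
    simp only [ContinuousLinearMap.inr_apply, Prod.mk_add_mk, zero_add, add_zero] at slice
    simp [iteratedDeriv_eq_iteratedFDeriv, slice]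
  rw [waveOperator, space, time, minkowskiTrace_apply]

theorem waveOperator_sub {u v : 𝔼 × ℝ → ℝ} (hu : ContDiff ℝ 2 u) (hv : ContDiff ℝ 2 v)
    (p : 𝔼 × ℝ) : waveOperator (fun q => u q - v q) p = waveOperator u p - waveOperator v p := by
  rw [waveOperator_eq_minkowskiTrace (hu.sub hv), waveOperator_eq_minkowskiTrace hu,
    waveOperator_eq_minkowskiTrace hv, ← map_sub]
  exact congrArg _ (iteratedFDeriv_sub_apply hu.contDiffAt hv.contDiffAt)

theorem waveOperator_congr {u v : 𝔼 × ℝ → ℝ} {p : 𝔼 × ℝ} (h : u =ᶠ[𝓝 p] v) :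
    waveOperator u p = waveOperator v p := by
  have space : (fun y => u (y, p.2)) =ᶠ[𝓝 p.1] fun y => v (y, p.2) :=
    (Continuous.prodMk_left p.2).continuousAt.eventually h
  have time : (fun s => u (p.1, s)) =ᶠ[𝓝 p.2] fun s => v (p.1, s) :=
    (Continuous.prodMk_right p.1).continuousAt.eventually h
  rw [waveOperator, waveOperator, (laplacian_congr_nhds space).eq_of_nhds,
    time.iteratedDeriv_eq 2]

section EnergyMethod

variable {E : Type*} [NormedAddCommGroup E] [NormedSpace ℝ E]

theorem fderiv_apply_comp_prodMk_left {u : E × ℝ → ℝ} (hu : Differentiable ℝ u) (x v : E) (t : ℝ) :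
    fderiv ℝ (fun y => u (y, t)) x v = fderiv ℝ u (x, t) (v, 0) := by
  have chain : HasFDerivAt (fun y => u (y, t)) _ x :=
    (hu (x, t)).hasFDerivAt.comp x (hasFDerivAt_prodMk_left x t)
  simp [chain.fderiv]

theorem hasDerivAt_comp_prodMk_right {u : E × ℝ → ℝ} (hu : Differentiable ℝ u) (x : E) (t : ℝ) :
    HasDerivAt (fun s => u (x, s)) (fderiv ℝ u (x, t) (0, 1)) t :=
  (hu (x, t)).hasFDerivAt.comp_hasDerivAt t ((hasDerivAt_const t x).prodMk (hasDerivAt_id t))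

theorem contDiff_fderiv_apply_const {F : Type*} [NormedAddCommGroup F] [NormedSpace ℝ F]
    {u : E → F} {k : WithTop ℕ∞} (hu : ContDiff ℝ (k + 1) u) (v : E) :
    ContDiff ℝ k fun p => fderiv ℝ u p v :=
  (hu.fderiv_right le_rfl).clm_apply contDiff_const

theorem fderiv_fderiv_apply_const {u : E → ℝ} (hu : ContDiff ℝ 2 u) (p v v' : E) :
    fderiv ℝ (fun q => fderiv ℝ u q v) p v' = fderiv ℝ (fderiv ℝ u) p v' v := by
  have : DifferentiableAt ℝ (fderiv ℝ u) p :=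
    (hu.fderiv_right (m := 1) (by norm_num)).differentiable one_ne_zero p
  simp [fderiv_clm_apply this (differentiableAt_const v)]

theorem setIntegral_fderiv_apply_eq_zero [FiniteDimensional ℝ E] [MeasurableSpace E] [BorelSpace E]
    {μ : Measure E} [μ.IsAddHaarMeasure] {f : E → ℝ} {K : Set E} (hf : ContDiff ℝ 1 f)
    (hK : IsCompact K) (hfK : Function.support f ⊆ K) (v : E) :
    ∫ x in K, fderiv ℝ f x v ∂μ = 0 := by
  have support_closed : tsupport f ⊆ K := closure_minimal hfK hK.isClosed
  have compact : HasCompactSupport f := hK.of_isClosed_subset (isClosed_tsupport f) support_closed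
  rw [setIntegral_eq_integral_of_forall_compl_eq_zero fun x hx => by
    simp [fderiv_of_notMem_tsupport (𝕜 := ℝ) fun h => hx (support_closed h)]]
  have integrable_fderiv : Integrable (fun x => fderiv ℝ f x v) μ :=
    ((hf.continuous_fderiv one_ne_zero).clm_apply
      continuous_const).integrable_of_hasCompactSupport (compact.fderiv_apply (𝕜 := ℝ) v)
  simpa using integral_mul_fderiv_eq_neg_fderiv_mul_of_integrable (μ := μ)
    (f := fun _ => (1 : ℝ)) (g := f) (v := v) (by simp) (by simpa using integrable_fderiv)
    (by simpa using hf.continuous.integrable_of_hasCompactSupport compact)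
    (fun _ _ => differentiableAt_const _) (fun x _ => hf.differentiable one_ne_zero x)

theorem hasDerivAt_setIntegral_prodMk_right [MeasurableSpace E] [BorelSpace E]
    [SecondCountableTopology E] {μ : Measure E} [IsFiniteMeasureOnCompacts μ] {F : E × ℝ → ℝ}
    {K : Set E} (hF : ContDiff ℝ 1 F) (hK : IsCompact K) (t : ℝ) :
    HasDerivAt (fun s => ∫ x in K, F (x, s) ∂μ) (∫ x in K, fderiv ℝ F (x, t) (0, 1) ∂μ) t := by
  have continuous_deriv : Continuous fun p => fderiv ℝ F p (0, 1) :=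
    (hF.continuous_fderiv one_ne_zero).clm_apply continuous_const
  obtain ⟨C, hC⟩ := (hK.prod (isCompact_closedBall t 1)).exists_bound_of_continuousOn
    continuous_deriv.continuousOn
  refine (hasDerivAt_integral_of_dominated_loc_of_deriv_le (Metric.ball_mem_nhds t one_pos)
    (F := fun s x => F (x, s)) (F' := fun s x => fderiv ℝ F (x, s) (0, 1)) (bound := fun _ => C)
    (Eventually.of_forall fun s => ?_) ?_ ?_ ?_ ?_ ?_).2
  · exact (hF.continuous.comp (Continuous.prodMk_left s)).aestronglyMeasurable
  · exact (hF.continuous.comp (Continuous.prodMk_left t)).continuousOn.integrableOn_compact hK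
  · exact (continuous_deriv.comp (Continuous.prodMk_left t)).aestronglyMeasurable
  · exact (ae_restrict_iff' hK.measurableSet).2 (Eventually.of_forall fun x hx s hs =>
      hC (x, s) ⟨hx, Metric.ball_subset_closedBall hs⟩)
  · exact integrableOn_const hK.measure_lt_top.ne
  · exact Eventually.of_forall fun x s _ =>
      hasDerivAt_comp_prodMk_right (hF.differentiable one_ne_zero) x s

theorem deriv_expNegInvGlue_eq_zero {y : ℝ} (hy : y ≤ 0) : deriv expNegInvGlue y = 0 := by
  refine IsLocalMin.deriv_eq_zero (Eventually.of_forall fun z => ?_)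
  rw [expNegInvGlue.zero_of_nonpos hy]
  exact expNegInvGlue.nonneg z

/-- A smooth weight on `ℝⁿ × ℝ` which, at times `t < R`, is positive exactly on the backward light
cone `‖x‖ < R - t` with apex `(0, R)`. -/
noncomputable def coneCutoff (n : ℕ) (R : ℝ) (p : EuclideanSpace ℝ (Fin n) × ℝ) : ℝ :=
  expNegInvGlue ((R - p.2) ^ 2 - ‖p.1‖ ^ 2)

theorem contDiff_coneCutoff (R : ℝ) : ContDiff ℝ 1 (coneCutoff n R) :=
  expNegInvGlue.contDiff.comp
    (((contDiff_const.sub contDiff_snd).pow 2).sub (contDiff_fst.norm_sq ℝ))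

theorem fderiv_coneCutoff (R : ℝ) (p v : 𝔼 × ℝ) :
    fderiv ℝ (coneCutoff n R) p v =
      -(2 * deriv expNegInvGlue ((R - p.2) ^ 2 - ‖p.1‖ ^ 2)) *
        ((R - p.2) * v.2 + ⟪p.1, v.1⟫_ℝ) := by
  have inside : HasFDerivAt (fun q : 𝔼 × ℝ => (R - q.2) ^ 2 - ‖q.1‖ ^ 2) _ p :=
    ((hasFDerivAt_snd.const_sub R).pow 2).sub hasFDerivAt_fst.norm_sq
  have glue : HasDerivAt expNegInvGlue _ ((R - p.2) ^ 2 - ‖p.1‖ ^ 2) :=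
    ((expNegInvGlue.contDiff (n := 1)).differentiable one_ne_zero _).hasDerivAt
  have chain : HasFDerivAt (coneCutoff n R) _ p := glue.comp_hasFDerivAt p inside
  rw [chain.fderiv]
  simp
  ring

theorem coneCutoff_nonneg (R : ℝ) (p : 𝔼 × ℝ) : 0 ≤ coneCutoff n R p := expNegInvGlue.nonneg _

theorem coneCutoff_pos_iff {R t : ℝ} {x : 𝔼} (ht : t < R) :
    0 < coneCutoff n R (x, t) ↔ ‖x‖ < R - t := by
  rw [(coneCutoff_nonneg R _).lt_iff_ne', coneCutoff, ne_eq, expNegInvGlue.zero_iff_nonpos,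
    sub_nonpos, not_le, sq_lt_sq₀ (norm_nonneg x) (sub_nonneg.2 ht.le)]

/-- The energy density `(w_t² + |∇w|²) / 2`. -/
noncomputable def energyDensity (w : EuclideanSpace ℝ (Fin n) × ℝ → ℝ)
    (p : EuclideanSpace ℝ (Fin n) × ℝ) : ℝ :=
  (fderiv ℝ w p (0, 1) ^ 2 + ∑ j, fderiv ℝ w p (EuclideanSpace.single j 1, 0) ^ 2) / 2

theorem energyDensity_nonneg (w : 𝔼 × ℝ → ℝ) (p : 𝔼 × ℝ) : 0 ≤ energyDensity w p := by
  unfold energyDensity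
  positivity

theorem contDiff_energyDensity {w : 𝔼 × ℝ → ℝ} (hw : ContDiff ℝ 2 w) :
    ContDiff ℝ 1 (energyDensity w) :=
  (((contDiff_fderiv_apply_const hw _).pow 2).add
    (ContDiff.sum fun _ _ => (contDiff_fderiv_apply_const hw _).pow 2)).div_const 2

theorem fderiv_time_eq_zero_of_energyDensity_eq_zero {w : 𝔼 × ℝ → ℝ} {p : 𝔼 × ℝ}
    (h : energyDensity w p = 0) : fderiv ℝ w p (0, 1) = 0 := by
  have gradient_nonneg : 0 ≤ ∑ j, fderiv ℝ w p (EuclideanSpace.single j 1, 0) ^ 2 := by positivity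
  unfold energyDensity at h
  nlinarith [sq_nonneg (fderiv ℝ w p (0, 1))]

theorem fderiv_energyDensity {w : 𝔼 × ℝ → ℝ} (hw : ContDiff ℝ 2 w) (p v : 𝔼 × ℝ) :
    fderiv ℝ (energyDensity w) p v =
      fderiv ℝ w p (0, 1) * fderiv ℝ (fderiv ℝ w) p v (0, 1) +
        ∑ j, fderiv ℝ w p (EuclideanSpace.single j 1, 0) *
          fderiv ℝ (fderiv ℝ w) p v (EuclideanSpace.single j 1, 0) := by
  have partials (v' : 𝔼 × ℝ) : HasFDerivAt (fun q => fderiv ℝ w q v') _ p :=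
    ((contDiff_fderiv_apply_const (k := 1) hw v').differentiable (by simp) p).hasFDerivAt
  have energy : HasFDerivAt (energyDensity w) _ p :=
    (((partials (0, 1)).pow 2).add (HasFDerivAt.fun_sum (u := Finset.univ) fun j _ =>
      (partials (EuclideanSpace.single j 1, 0)).pow 2)).mul_const (2⁻¹ : ℝ)
  rw [energy.fderiv]
  simp [fderiv_fderiv_apply_const hw, mul_assoc, ← Finset.mul_sum]

theorem fderiv_mul_energyDensity {w χ : 𝔼 × ℝ → ℝ} (hw : ContDiff ℝ 2 w)
    (hχ : ContDiff ℝ 1 χ) {p : 𝔼 × ℝ} (hwave : waveOperator w p = 0) :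
    fderiv ℝ (fun q => χ q * energyDensity w q) p (0, 1) =
      fderiv ℝ χ p (0, 1) * energyDensity w p
      - ∑ j, fderiv ℝ χ p (EuclideanSpace.single j 1, 0) *
          (fderiv ℝ w p (0, 1) * fderiv ℝ w p (EuclideanSpace.single j 1, 0))
      + ∑ j, fderiv ℝ (fun q => χ q *
          (fderiv ℝ w q (0, 1) * fderiv ℝ w q (EuclideanSpace.single j 1, 0))) p
          (EuclideanSpace.single j 1, 0) := by
  have cutoff : HasFDerivAt χ _ p := (hχ.differentiable one_ne_zero p).hasFDerivAt
  have partials (v : 𝔼 × ℝ) : HasFDerivAt (fun q => fderiv ℝ w q v) _ p :=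
    ((contDiff_fderiv_apply_const (k := 1) hw v).differentiable (by simp) p).hasFDerivAt
  have time_time : fderiv ℝ (fderiv ℝ w) p (0, 1) (0, 1) =
      ∑ j, fderiv ℝ (fderiv ℝ w) p (EuclideanSpace.single j 1, 0)
        (EuclideanSpace.single j 1, 0) := by
    rw [waveOperator_eq_minkowskiTrace hw, minkowskiTrace_apply, sub_eq_zero] at hwave
    simpa only [iteratedFDeriv_two_apply] using hwave.symm
  have energy : fderiv ℝ (fun q => χ q * energyDensity w q) p (0, 1) =
      χ p * fderiv ℝ (energyDensity w) p (0, 1) + energyDensity w p * fderiv ℝ χ p (0, 1) := by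
    rw [(cutoff.fun_mul ((contDiff_energyDensity hw).differentiable
      one_ne_zero p).hasFDerivAt).fderiv]
    simp
  have flux (j : Fin n) : fderiv ℝ (fun q => χ q *
        (fderiv ℝ w q (0, 1) * fderiv ℝ w q (EuclideanSpace.single j 1, 0))) p
          (EuclideanSpace.single j 1, 0) =
      fderiv ℝ χ p (EuclideanSpace.single j 1, 0) *
          (fderiv ℝ w p (0, 1) * fderiv ℝ w p (EuclideanSpace.single j 1, 0)) +
        χ p * (fderiv ℝ w p (EuclideanSpace.single j 1, 0) *
          fderiv ℝ (fderiv ℝ w) p (0, 1) (EuclideanSpace.single j 1, 0)) +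
        χ p * (fderiv ℝ w p (0, 1) * fderiv ℝ (fderiv ℝ w) p (EuclideanSpace.single j 1, 0)
          (EuclideanSpace.single j 1, 0)) := by
    rw [(cutoff.fun_mul ((partials (0, 1)).fun_mul
        (partials (EuclideanSpace.single j 1, 0)))).fderiv,
      hw.contDiffAt.isSymmSndFDerivAt (by simp) (0, 1)]
    simp [fderiv_fderiv_apply_const hw]
    ring
  rw [Finset.sum_congr rfl fun j _ => flux j, energy, fderiv_energyDensity hw, time_time]
  simp only [Finset.sum_add_distrib, ← Finset.mul_sum]
  ring

theorem sum_mul_mul_le_mul_half_add {ι : Type*} [Fintype ι] {x b : ι → ℝ} {a r : ℝ} (hr : 0 < r)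
    (hx : ∑ i, x i ^ 2 ≤ r ^ 2) : ∑ i, x i * (a * b i) ≤ r * ((a ^ 2 + ∑ i, b i ^ 2) / 2) := by
  have termwise (i : ι) : r * (x i * (a * b i)) ≤ (x i ^ 2 * a ^ 2 + r ^ 2 * b i ^ 2) / 2 := by
    nlinarith [sq_nonneg (x i * a - r * b i)]
  refine le_of_mul_le_mul_left ?_ hr
  calc r * ∑ i, x i * (a * b i)
      ≤ ∑ i, (x i ^ 2 * a ^ 2 + r ^ 2 * b i ^ 2) / 2 := by
        rw [Finset.mul_sum]
        exact Finset.sum_le_sum fun i _ => termwise i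
    _ = ((∑ i, x i ^ 2) * a ^ 2 + r ^ 2 * ∑ i, b i ^ 2) / 2 := by
        rw [← Finset.sum_div, Finset.sum_add_distrib, Finset.sum_mul, Finset.mul_sum]
    _ ≤ (r ^ 2 * a ^ 2 + r ^ 2 * ∑ i, b i ^ 2) / 2 := by gcongr
    _ = r * (r * ((a ^ 2 + ∑ i, b i ^ 2) / 2)) := by ring

-- Energy leaves the cone, and does not enter it, because waves travel with speed at most one.
theorem fderiv_coneCutoff_mul_energyDensity_le (w : 𝔼 × ℝ → ℝ) {R : ℝ} {p : 𝔼 × ℝ} (hp : p.2 < R) :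
    fderiv ℝ (coneCutoff n R) p (0, 1) * energyDensity w p ≤
      ∑ j, fderiv ℝ (coneCutoff n R) p (EuclideanSpace.single j 1, 0) *
        (fderiv ℝ w p (0, 1) * fderiv ℝ w p (EuclideanSpace.single j 1, 0)) := by
  obtain ⟨x, t⟩ := p
  have hr : 0 < R - t := sub_pos.2 hp
  simp only [fderiv_coneCutoff, inner_zero_right, EuclideanSpace.inner_single_right, mul_assoc,
    ← Finset.mul_sum]
  rcases le_or_gt ((R - t) ^ 2 - ‖x‖ ^ 2) 0 with outside | inside
  · simp [deriv_expNegInvGlue_eq_zero outside]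
  · have hx : ∑ j, x j ^ 2 ≤ (R - t) ^ 2 := by
      rw [← EuclideanSpace.real_norm_sq_eq]
      exact (sub_pos.1 inside).le
    have flux := sum_mul_mul_le_mul_half_add (a := fderiv ℝ w (x, t) (0, 1))
      (b := fun j => fderiv ℝ w (x, t) (EuclideanSpace.single j 1, 0)) hr hx
    have slope : 0 ≤ deriv expNegInvGlue ((R - t) ^ 2 - ‖x‖ ^ 2) :=
      expNegInvGlue.monotone.deriv_nonneg
    simpa [energyDensity] using mul_le_mul_of_nonneg_left flux (mul_nonneg zero_le_two slope)

theorem setIntegral_fderiv_coneCutoff_mul_energyDensity_nonpos {w : 𝔼 × ℝ → ℝ} {R t : ℝ}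
    (hw : ContDiff ℝ 2 w) (hwave : ∀ p, waveOperator w p = 0) (ht : t ∈ Ico 0 R) :
    ∫ x in Metric.closedBall 0 R,
      fderiv ℝ (fun q => coneCutoff n R q * energyDensity w q) (x, t) (0, 1) ≤ 0 := by
  set flux : Fin n → 𝔼 × ℝ → ℝ := fun j q => coneCutoff n R q *
    (fderiv ℝ w q (0, 1) * fderiv ℝ w q (EuclideanSpace.single j 1, 0))
  have hflux (j : Fin n) : ContDiff ℝ 1 (flux j) := (contDiff_coneCutoff R).mul
    ((contDiff_fderiv_apply_const hw _).mul (contDiff_fderiv_apply_const hw _))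
  have hball := isCompact_closedBall (0 : 𝔼) R
  have integrable {F : 𝔼 × ℝ → ℝ} (hF : ContDiff ℝ 1 F) (v : 𝔼 × ℝ) :
      IntegrableOn (fun x => fderiv ℝ F (x, t) v) (Metric.closedBall 0 R) :=
    (((hF.continuous_fderiv one_ne_zero).comp (Continuous.prodMk_left t)).clm_apply
      continuous_const).continuousOn.integrableOn_compact hball
  have divergence (j : Fin n) : ∫ x in Metric.closedBall 0 R,
      fderiv ℝ (flux j) (x, t) (EuclideanSpace.single j 1, 0) = 0 := by
    simp only [← fderiv_apply_comp_prodMk_left ((hflux j).differentiable one_ne_zero)]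
    refine setIntegral_fderiv_apply_eq_zero
      ((hflux j).comp (contDiff_id.prodMk contDiff_const)) hball (fun x hx => ?_) _
    have inside := (coneCutoff_pos_iff ht.2).1
      ((coneCutoff_nonneg R _).lt_of_ne' (left_ne_zero_of_mul hx))
    exact mem_closedBall_zero_iff.2 (inside.le.trans (sub_le_self R ht.1))
  calc ∫ x in Metric.closedBall 0 R,
        fderiv ℝ (fun q => coneCutoff n R q * energyDensity w q) (x, t) (0, 1)
      ≤ ∫ x in Metric.closedBall 0 R,
          ∑ j, fderiv ℝ (flux j) (x, t) (EuclideanSpace.single j 1, 0) := by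
        refine integral_mono
          (integrable ((contDiff_coneCutoff R).mul (contDiff_energyDensity hw)) _)
          (integrable_finsetSum _ fun j _ => integrable (hflux j) _) fun x => ?_
        have identity := fderiv_mul_energyDensity hw (contDiff_coneCutoff R) (hwave (x, t))
        have outflow := fderiv_coneCutoff_mul_energyDensity_le w (p := (x, t)) ht.2
        linarith
    _ = 0 := by
        rw [integral_finsetSum _ fun j _ => integrable (hflux j) _]
        exact Finset.sum_eq_zero fun j _ => divergence j

theorem energyDensity_eq_zero_of_data {w : 𝔼 × ℝ → ℝ} {R : ℝ} (hw : ContDiff ℝ 2 w)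
    (h₀ : ∀ x, ‖x‖ < R → w (x, 0) = 0) (h₁ : ∀ x, ‖x‖ < R → fderiv ℝ w (x, 0) (0, 1) = 0)
    {x : 𝔼} (hx : ‖x‖ < R) : energyDensity w (x, 0) = 0 := by
  have gradient (v : 𝔼) : fderiv ℝ w (x, 0) (v, 0) = 0 := by
    have vanishes : (fun y => w (y, 0)) =ᶠ[𝓝 x] fun _ => 0 := by
      filter_upwards [(isOpen_lt continuous_norm continuous_const).mem_nhds hx] using h₀
    rw [← fderiv_apply_comp_prodMk_left (hw.differentiable two_ne_zero), vanishes.fderiv_eq]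
    simp
  simp [energyDensity, gradient, h₁ x hx]

theorem setIntegral_coneCutoff_mul_energyDensity_eq_zero {w : 𝔼 × ℝ → ℝ} {R t : ℝ}
    (hw : ContDiff ℝ 2 w) (hwave : ∀ p, waveOperator w p = 0)
    (h₀ : ∀ x, ‖x‖ < R → w (x, 0) = 0) (h₁ : ∀ x, ‖x‖ < R → fderiv ℝ w (x, 0) (0, 1) = 0)
    (ht : t ∈ Ico 0 R) :
    ∫ x in Metric.closedBall 0 R, coneCutoff n R (x, t) * energyDensity w (x, t) = 0 := by
  have energy_deriv (s : ℝ) := hasDerivAt_setIntegral_prodMk_right (μ := volume)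
    ((contDiff_coneCutoff R).mul (contDiff_energyDensity hw)) (isCompact_closedBall (0 : 𝔼) R) s
  have antitone : AntitoneOn (fun s => ∫ x in Metric.closedBall 0 R,
      coneCutoff n R (x, s) * energyDensity w (x, s)) (Ico 0 R) := by
    refine antitoneOn_of_deriv_nonpos (convex_Ico 0 R)
      (fun s _ => (energy_deriv s).continuousAt.continuousWithinAt)
      (fun s _ => (energy_deriv s).differentiableAt.differentiableWithinAt) fun s hs => ?_
    rw [(energy_deriv s).deriv]
    exact setIntegral_fderiv_coneCutoff_mul_energyDensity_nonpos hw hwave (interior_subset hs)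
  have hR : 0 < R := ht.1.trans_lt ht.2
  have initial : ∫ x in Metric.closedBall 0 R,
      coneCutoff n R (x, 0) * energyDensity w (x, 0) = 0 := by
    refine integral_eq_zero_of_ae (Eventually.of_forall fun x => mul_eq_zero.2 ?_)
    refine or_iff_not_imp_left.2 fun hx => energyDensity_eq_zero_of_data hw h₀ h₁ ?_
    simpa using (coneCutoff_pos_iff hR).1 ((coneCutoff_nonneg R _).lt_of_ne' hx)
  exact le_antisymm ((antitone (left_mem_Ico.2 hR) ht ht.1).trans_eq initial)
    (integral_nonneg fun x => mul_nonneg (coneCutoff_nonneg R _) (energyDensity_nonneg w _))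

theorem energyDensity_eq_zero_of_mem_cone {w : 𝔼 × ℝ → ℝ} {R : ℝ} (hw : ContDiff ℝ 2 w)
    (hwave : ∀ p, waveOperator w p = 0) (h₀ : ∀ x, ‖x‖ < R → w (x, 0) = 0)
    (h₁ : ∀ x, ‖x‖ < R → fderiv ℝ w (x, 0) (0, 1) = 0) {x : 𝔼} {t : ℝ} (ht : 0 ≤ t)
    (hx : ‖x‖ + t < R) : energyDensity w (x, t) = 0 := by
  have htR : t < R := (le_add_of_nonneg_left (norm_nonneg x)).trans_lt hx
  have continuous_density : Continuous fun y : 𝔼 =>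
      coneCutoff n R (y, t) * energyDensity w (y, t) :=
    ((contDiff_coneCutoff R).continuous.mul (contDiff_energyDensity hw).continuous).comp
      (Continuous.prodMk_left t)
  have vanishes_ae := (setIntegral_eq_zero_iff_of_nonneg_ae
    (Eventually.of_forall fun y => mul_nonneg (coneCutoff_nonneg R _) (energyDensity_nonneg w _))
    (continuous_density.continuousOn.integrableOn_compact (isCompact_closedBall 0 R))).1
    (setIntegral_coneCutoff_mul_energyDensity_eq_zero hw hwave h₀ h₁ ⟨ht, htR⟩)
  have vanishes : EqOn (fun y : 𝔼 => coneCutoff n R (y, t) * energyDensity w (y, t)) 0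
      (Metric.ball 0 R) :=
    Measure.eqOn_open_of_ae_eq (ae_restrict_of_ae_restrict_of_subset
      Metric.ball_subset_closedBall vanishes_ae) Metric.isOpen_ball
      continuous_density.continuousOn continuousOn_const
  have cutoff_pos : 0 < coneCutoff n R (x, t) := (coneCutoff_pos_iff htR).2 (lt_sub_iff_add_lt.2 hx)
  exact (mul_eq_zero.1 (vanishes (mem_ball_zero_iff.2 (by linarith)))).resolve_left cutoff_pos.ne'

theorem eq_zero_of_data_eq_zero_of_nonneg {w : 𝔼 × ℝ → ℝ} {R : ℝ} (hw : ContDiff ℝ 2 w)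
    (hwave : ∀ p, waveOperator w p = 0) (h₀ : ∀ x, ‖x‖ < R → w (x, 0) = 0)
    (h₁ : ∀ x, ‖x‖ < R → fderiv ℝ w (x, 0) (0, 1) = 0) {x : 𝔼} {t : ℝ} (ht : 0 ≤ t)
    (hx : ‖x‖ + t < R) : w (x, t) = 0 := by
  have time_deriv (s : ℝ) : HasDerivAt (fun s => w (x, s)) _ s :=
    hasDerivAt_comp_prodMk_right (hw.differentiable two_ne_zero) x s
  have constant : w (x, t) = w (x, 0) := constant_of_has_deriv_right_zero
    (fun s _ => (time_deriv s).continuousAt.continuousWithinAt)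
    (fun s hs => by
      have still := fderiv_time_eq_zero_of_energyDensity_eq_zero
        (energyDensity_eq_zero_of_mem_cone hw hwave h₀ h₁ hs.1 (by linarith [hs.2]))
      exact still ▸ (time_deriv s).hasDerivWithinAt) t (right_mem_Icc.2 ht)
  rw [constant]
  exact h₀ x (by linarith)

theorem waveOperator_comp_neg (w : 𝔼 × ℝ → ℝ) (p : 𝔼 × ℝ) :
    waveOperator (fun q => w (q.1, -q.2)) p = waveOperator w (p.1, -p.2) := by
  simp [waveOperator, iteratedDeriv_comp_neg 2 fun s => w (p.1, s)]

theorem eq_zero_of_data_eq_zero {w : 𝔼 × ℝ → ℝ} {R : ℝ} (hw : ContDiff ℝ 2 w)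
    (hwave : ∀ p, waveOperator w p = 0) (h₀ : ∀ x, ‖x‖ < R → w (x, 0) = 0)
    (h₁ : ∀ x, ‖x‖ < R → fderiv ℝ w (x, 0) (0, 1) = 0) {x : 𝔼} {t : ℝ} (hx : ‖x‖ + |t| < R) :
    w (x, t) = 0 := by
  rcases le_total 0 t with ht | ht
  · exact eq_zero_of_data_eq_zero_of_nonneg hw hwave h₀ h₁ ht (by rwa [abs_of_nonneg ht] at hx)
  · have reversed : ContDiff ℝ 2 fun q : 𝔼 × ℝ => w (q.1, -q.2) :=
      hw.comp (contDiff_fst.prodMk contDiff_snd.neg)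
    have reversed_h₁ (y : 𝔼) (hy : ‖y‖ < R) :
        fderiv ℝ (fun q : 𝔼 × ℝ => w (q.1, -q.2)) (y, 0) (0, 1) = 0 := by
      have chain := (hasDerivAt_comp_prodMk_right (hw.differentiable two_ne_zero) y (-0)).scomp
        (0 : ℝ) (hasDerivAt_neg 0)
      rw [(hasDerivAt_comp_prodMk_right (reversed.differentiable two_ne_zero) y 0).unique chain]
      simpa using h₁ y hy
    simpa using eq_zero_of_data_eq_zero_of_nonneg reversed
      (fun p => by rw [waveOperator_comp_neg, hwave]) (by simpa using h₀) reversed_h₁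
      (neg_nonneg.2 ht) (by rwa [abs_of_nonpos ht] at hx)

end EnergyMethod

/-- `u` is a `C^m` solution of the wave equation on all of `ℝⁿ × ℝ`, whose value and time derivative
at `t = 0` are `u₀` and `u₁` almost everywhere on `S` only. -/
structure SolvesCauchyProblem (m : ℕ) (S : Set (EuclideanSpace ℝ (Fin n)))
    (u₀ u₁ : EuclideanSpace ℝ (Fin n) → ℝ) (u : EuclideanSpace ℝ (Fin n) × ℝ → ℝ) : Prop where
  contDiff : ContDiff ℝ m u
  wave : ∀ p, waveOperator u p = 0
  position : (fun x => u (x, 0)) =ᵐ[volume.restrict S] u₀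
  velocity : (fun x => deriv (fun t => u (x, t)) 0) =ᵐ[volume.restrict S] u₁

theorem SolvesCauchyProblem.mono {m m' : ℕ} {S S' : Set 𝔼} {u₀ u₁ : 𝔼 → ℝ} {u : 𝔼 × ℝ → ℝ}
    (hu : SolvesCauchyProblem m S u₀ u₁ u) (hm : m' ≤ m) (hS : S' ⊆ S) :
    SolvesCauchyProblem m' S' u₀ u₁ u where
  contDiff := hu.contDiff.of_le (by exact_mod_cast hm)
  wave := hu.wave
  position := ae_restrict_of_ae_restrict_of_subset hS hu.position
  velocity := ae_restrict_of_ae_restrict_of_subset hS hu.velocity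

theorem SolvesCauchyProblem.eq_of_mem_cone {u₀ u₁ : 𝔼 → ℝ} {u v : 𝔼 × ℝ → ℝ} {R : ℝ}
    (hu : SolvesCauchyProblem 2 (Metric.ball 0 R) u₀ u₁ u)
    (hv : SolvesCauchyProblem 2 (Metric.ball 0 R) u₀ u₁ v) {p : 𝔼 × ℝ}
    (hp : ‖p.1‖ + |p.2| < R) : u p = v p := by
  have diff_u : Differentiable ℝ u := hu.contDiff.differentiable (by simp)
  have diff_v : Differentiable ℝ v := hv.contDiff.differentiable (by simp)
  have continuous_velocity {f : 𝔼 × ℝ → ℝ} (hf : ContDiff ℝ 2 f) :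
      Continuous fun x : 𝔼 => fderiv ℝ f (x, 0) (0, 1) :=
    (contDiff_fderiv_apply_const (k := 1) hf _).continuous.comp (Continuous.prodMk_left 0)
  have position : EqOn (fun x => u (x, 0)) (fun x => v (x, 0)) (Metric.ball 0 R) :=
    Measure.eqOn_open_of_ae_eq (hu.position.trans hv.position.symm) Metric.isOpen_ball
      (hu.contDiff.continuous.comp (Continuous.prodMk_left 0)).continuousOn
      (hv.contDiff.continuous.comp (Continuous.prodMk_left 0)).continuousOn
  have velocity : EqOn (fun x => fderiv ℝ u (x, 0) (0, 1)) (fun x => fderiv ℝ v (x, 0) (0, 1))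
      (Metric.ball 0 R) := by
    refine Measure.eqOn_open_of_ae_eq (μ := volume) ?_ Metric.isOpen_ball
      (continuous_velocity hu.contDiff).continuousOn (continuous_velocity hv.contDiff).continuousOn
    filter_upwards [hu.velocity, hv.velocity] with x hux hvx
    rw [← (hasDerivAt_comp_prodMk_right diff_u x 0).deriv,
      ← (hasDerivAt_comp_prodMk_right diff_v x 0).deriv, hux, hvx]
  refine sub_eq_zero.1 (eq_zero_of_data_eq_zero (w := fun q => u q - v q)
    (hu.contDiff.sub hv.contDiff) (fun q => ?_) (fun x hx => ?_) (fun x hx => ?_) hp)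
  · rw [waveOperator_sub hu.contDiff hv.contDiff, hu.wave, hv.wave, sub_zero]
  · exact sub_eq_zero.2 (position (mem_ball_zero_iff.2 hx))
  · rw [fderiv_fun_sub (diff_u _) (diff_v _)]
    exact sub_eq_zero.2 (velocity (mem_ball_zero_iff.2 hx))

theorem exists_eventuallyEq_of_eq_on_sublevels {X Y : Type*} [TopologicalSpace X] {ρ : X → ℝ}
    (hρ : Continuous ρ) {U : ℕ → X → Y}
    (hU : ∀ (M N : ℕ) (p), ρ p < M → ρ p < N → U M p = U N p) :
    ∃ u : X → Y, ∀ (N : ℕ) (p), ρ p < N → u =ᶠ[𝓝 p] U N := by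
  have bound (p : X) : ρ p < (⌈ρ p⌉₊ + 1 : ℕ) :=
    (Nat.le_ceil _).trans_lt (by exact_mod_cast Nat.lt_succ_self _)
  refine ⟨fun p => U (⌈ρ p⌉₊ + 1) p, fun N p hp => ?_⟩
  filter_upwards [(isOpen_lt hρ continuous_const).mem_nhds hp] with q hq
  exact hU _ _ q (bound q) hq

theorem exists_solvesCauchyProblem_univ {m : ℕ} (hm : 2 ≤ m) {u₀ u₁ : 𝔼 → ℝ}
    (hloc : ∀ R : ℝ, ∃ u, SolvesCauchyProblem m (Metric.ball 0 R) u₀ u₁ u) :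
    ∃ u, SolvesCauchyProblem m univ u₀ u₁ u := by
  choose U hU using fun N : ℕ => hloc N
  obtain ⟨u, hu⟩ := exists_eventuallyEq_of_eq_on_sublevels
    (ρ := fun p : 𝔼 × ℝ => ‖p.1‖ + |p.2|) (U := U) (by fun_prop) fun M N p hM hN =>
      SolvesCauchyProblem.eq_of_mem_cone (R := min (M : ℝ) N)
        ((hU M).mono hm (Metric.ball_subset_ball (min_le_left _ _)))
        ((hU N).mono hm (Metric.ball_subset_ball (min_le_right _ _))) (lt_min hM hN)
  have eventually_eq (p : 𝔼 × ℝ) : ∃ N : ℕ, u =ᶠ[𝓝 p] U N :=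
    (exists_nat_gt (‖p.1‖ + |p.2|)).imp fun N hN => hu N p hN
  have cover {P : 𝔼 → Prop}
      (hP : ∀ N : ℕ, ∀ᵐ x ∂volume.restrict (Metric.ball (0 : 𝔼) N), P x) :
      ∀ᵐ x ∂volume.restrict univ, P x := by
    rw [← Metric.iUnion_ball_nat (0 : 𝔼), ae_restrict_iUnion_iff]
    exact hP
  have slice_eq {N : ℕ} {x : 𝔼} (hx : x ∈ Metric.ball 0 (N : ℝ)) :
      (fun t => u (x, t)) =ᶠ[𝓝 0] fun t => U N (x, t) :=
    (Continuous.prodMk_right x).continuousAt.eventually (hu N (x, 0) (by simpa using hx))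
  refine ⟨u, contDiff_iff_contDiffAt.2 fun p => ?_, fun p => ?_, cover fun N => ?_,
    cover fun N => ?_⟩
  · obtain ⟨N, hN⟩ := eventually_eq p
    exact (hU N).contDiff.contDiffAt.congr_of_eventuallyEq hN
  · obtain ⟨N, hN⟩ := eventually_eq p
    rw [waveOperator_congr hN, (hU N).wave]
  · filter_upwards [(hU N).position, ae_restrict_mem measurableSet_ball] with x position hx
    rw [(slice_eq hx).eq_of_nhds, position]
  · filter_upwards [(hU N).velocity, ae_restrict_mem measurableSet_ball] with x velocity hx
    rw [(slice_eq hx).deriv_eq, velocity]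

section ParametricIntegral

variable {α H E : Type*} [MeasurableSpace α] {μ : Measure α} [NormedAddCommGroup H]
  [NormedSpace ℝ H] [NormedAddCommGroup E] [NormedSpace ℝ E]

theorem aestronglyMeasurable_clm_of_apply [FiniteDimensional ℝ H] {L : α → H →L[ℝ] E}
    (hL : ∀ v, AEStronglyMeasurable (fun a => L a v) μ) : AEStronglyMeasurable L μ := by
  set b := Module.finBasis ℝ H
  have expansion : L = fun a => ∑ i, ContinuousLinearMap.smulRightL ℝ H E
      (LinearMap.toContinuousLinearMap (b.coord i)) (L a (b i)) := by
    ext a v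
    conv_lhs => rw [← b.sum_repr v, map_sum]
    simp
  rw [expansion]
  exact Finset.aestronglyMeasurable_fun_sum _ fun i _ =>
    (ContinuousLinearMap.continuous _).comp_aestronglyMeasurable (hL (b i))

theorem aestronglyMeasurable_fderiv_of_param [FiniteDimensional ℝ H] {f : α → H → E} {x : H}
    (hf : ∀ a, DifferentiableAt ℝ (f a) x) (hm : ∀ y, AEStronglyMeasurable (fun a => f a y) μ) :
    AEStronglyMeasurable (fun a => fderiv ℝ (f a) x) μ :=
  aestronglyMeasurable_clm_of_apply fun v =>
    aestronglyMeasurable_of_tendsto_ae atTop (fun c : ℝ => ((hm _).sub (hm _)).const_smul c)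
      (Eventually.of_forall fun a => (hf a).hasFDerivAt.lim_real v)

/-- A family of `C^N` functions of `x`, measurable in the parameter, whose derivatives of order up
to `N` are bounded, locally uniformly in `x`, by an integrable function of the parameter. -/
structure DominatedSmoothFamily (μ : Measure α) (N : ℕ) (f : α → H → E) : Prop where
  contDiff : ∀ a, ContDiff ℝ N (f a)
  aestronglyMeasurable : ∀ x, AEStronglyMeasurable (fun a => f a x) μ
  dominated : ∀ x₀, ∃ bound : α → ℝ, Integrable bound μ ∧
    ∀ᶠ x in 𝓝 x₀, ∀ k ≤ N, ∀ a, ‖iteratedFDeriv ℝ k (f a) x‖ ≤ bound a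

namespace DominatedSmoothFamily

variable [FiniteDimensional ℝ H] {N k : ℕ} {f : α → H → E}

theorem aestronglyMeasurable_iteratedFDeriv (hf : DominatedSmoothFamily μ N f) (hk : k ≤ N)
    (x : H) : AEStronglyMeasurable (fun a => iteratedFDeriv ℝ k (f a) x) μ := by
  induction k generalizing x with
  | zero =>
    exact (continuousMultilinearCurryFin0 ℝ H E).symm.continuous.comp_aestronglyMeasurable
      (hf.aestronglyMeasurable x)
  | succ k ih =>
    exact (continuousMultilinearCurryLeftEquiv ℝ (fun _ : Fin (k + 1) => H)
      E).symm.continuous.comp_aestronglyMeasurable (aestronglyMeasurable_fderiv_of_param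
        (fun a => (hf.contDiff a).differentiable_iteratedFDeriv (by exact_mod_cast hk) x)
        (ih (Nat.le_of_succ_le hk)))

theorem integrable_iteratedFDeriv (hf : DominatedSmoothFamily μ N f) (hk : k ≤ N) (x : H) :
    Integrable (fun a => iteratedFDeriv ℝ k (f a) x) μ := by
  obtain ⟨bound, integrable_bound, hbound⟩ := hf.dominated x
  exact integrable_bound.mono' (hf.aestronglyMeasurable_iteratedFDeriv hk x)
    (Eventually.of_forall (hbound.self_of_nhds k hk))

set_option maxSynthPendingDepth 3 in
theorem hasFTaylorSeriesUpTo_integral (hf : DominatedSmoothFamily μ N f) :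
    HasFTaylorSeriesUpTo N (fun x => ∫ a, f a x ∂μ)
      fun x k => ∫ a, iteratedFDeriv ℝ k (f a) x ∂μ where
  zero_eq x := (ContinuousMultilinearMap.integral_apply
    (hf.integrable_iteratedFDeriv (Nat.zero_le N) x) 0).trans (by simp)
  fderiv k hk x := by
    have hk' : k + 1 ≤ N := Nat.succ_le_of_lt (by exact_mod_cast hk)
    obtain ⟨bound, integrable_bound, hbound⟩ := hf.dominated x
    have derivative := hasFDerivAt_integral_of_dominated_of_fderiv_le (μ := μ)
      (F := fun y a => iteratedFDeriv ℝ k (f a) y)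
      (F' := fun y a => fderiv ℝ (iteratedFDeriv ℝ k (f a)) y) hbound
      (Eventually.of_forall fun y =>
        hf.aestronglyMeasurable_iteratedFDeriv (Nat.le_of_succ_le hk') y)
      (hf.integrable_iteratedFDeriv (Nat.le_of_succ_le hk') x)
      (aestronglyMeasurable_fderiv_of_param
        (fun a => (hf.contDiff a).differentiable_iteratedFDeriv (by exact_mod_cast hk') x)
        fun y => hf.aestronglyMeasurable_iteratedFDeriv (Nat.le_of_succ_le hk') y)
      (Eventually.of_forall fun a y hy => by
        simpa only [norm_fderiv_iteratedFDeriv] using hy (k + 1) hk' a) integrable_bound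
      (Eventually.of_forall fun a y _ =>
        ((hf.contDiff a).differentiable_iteratedFDeriv (by exact_mod_cast hk') y).hasFDerivAt)
    simp only [fderiv_iteratedFDeriv, Function.comp_apply] at derivative
    have curry_integral := (continuousMultilinearCurryLeftEquiv ℝ
      (fun _ : Fin (k + 1) => H) E).toContinuousLinearEquiv.integral_comp_comm (μ := μ)
        (fun a => iteratedFDeriv ℝ (k + 1) (f a) x)
    exact derivative.congr_fderiv curry_integral
  cont k hk := continuous_iff_continuousAt.2 fun x => by
    have hk' : k ≤ N := by exact_mod_cast hk
    obtain ⟨bound, integrable_bound, hbound⟩ := hf.dominated x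
    exact continuousAt_of_dominated
      (Eventually.of_forall (hf.aestronglyMeasurable_iteratedFDeriv hk'))
      (hbound.mono fun y hy => Eventually.of_forall (hy k hk')) integrable_bound
      (Eventually.of_forall fun a =>
        ((hf.contDiff a).continuous_iteratedFDeriv (by exact_mod_cast hk')).continuousAt)

theorem contDiff_integral (hf : DominatedSmoothFamily μ N f) :
    ContDiff ℝ N fun x => ∫ a, f a x ∂μ :=
  HasFTaylorSeriesUpTo.contDiff (n := (N : ℕ∞)) (by exact_mod_cast hf.hasFTaylorSeriesUpTo_integral)

theorem clm_iteratedFDeriv_integral [CompleteSpace E] {F : Type*} [NormedAddCommGroup F]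
    [NormedSpace ℝ F] [CompleteSpace F] (hf : DominatedSmoothFamily μ N f) (hk : k ≤ N)
    (L : (H [×k]→L[ℝ] E) →L[ℝ] F) (x : H) :
    L (iteratedFDeriv ℝ k (fun x => ∫ a, f a x ∂μ) x) =
      ∫ a, L (iteratedFDeriv ℝ k (f a) x) ∂μ := by
  rw [← hf.hasFTaylorSeriesUpTo_integral.eq_iteratedFDeriv (by exact_mod_cast hk) x]
  exact (L.integral_comp_comm (hf.integrable_iteratedFDeriv hk x)).symm

theorem fderiv_integral_apply [CompleteSpace E] (hf : DominatedSmoothFamily μ N f) (hN : 1 ≤ N)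
    (x v : H) : fderiv ℝ (fun x => ∫ a, f a x ∂μ) x v = ∫ a, fderiv ℝ (f a) x v ∂μ := by
  simpa only [ContinuousMultilinearMap.apply_apply, iteratedFDeriv_one_apply] using
    hf.clm_iteratedFDeriv_integral hN
      (ContinuousMultilinearMap.apply ℝ (fun _ : Fin 1 => H) E fun _ => v) x

end DominatedSmoothFamily

end ParametricIntegral

section PlaneWaves

/-- The real plane wave `r ↦ Re (c e^{2πir})` with complex amplitude `c`. -/
noncomputable def realPlaneWave (c : ℂ) (r : ℝ) : ℝ := ((𝐞 r : ℂ) * c).re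

theorem realPlaneWave_add (c d : ℂ) (r : ℝ) :
    realPlaneWave (c + d) r = realPlaneWave c r + realPlaneWave d r := by
  simp only [realPlaneWave, mul_add, Complex.add_re]

theorem realPlaneWave_ofReal_mul (s : ℝ) (c : ℂ) (r : ℝ) :
    realPlaneWave (s * c) r = s * realPlaneWave c r := by
  rw [realPlaneWave, mul_left_comm, Complex.re_ofReal_mul, realPlaneWave]

theorem abs_realPlaneWave_le (c : ℂ) (r : ℝ) : |realPlaneWave c r| ≤ ‖c‖ :=
  (Complex.abs_re_le_norm _).trans_eq (by rw [norm_mul, Circle.norm_coe, one_mul])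

theorem hasDerivAt_realPlaneWave (c : ℂ) (r : ℝ) :
    HasDerivAt (realPlaneWave c) (realPlaneWave (2 * Real.pi * Complex.I * c) r) r := by
  have complex_wave := ((Real.hasDerivAt_fourierChar r).mul_const c).hasFDerivAt
  refine (Complex.reCLM.hasFDerivAt.comp r complex_wave).hasDerivAt.congr_deriv ?_
  simp [realPlaneWave, mul_left_comm, mul_assoc]

theorem iteratedDeriv_realPlaneWave (k : ℕ) (c : ℂ) :
    iteratedDeriv k (realPlaneWave c) = realPlaneWave ((2 * Real.pi * Complex.I) ^ k * c) := by
  induction k with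
  | zero => simp
  | succ k ih =>
    rw [iteratedDeriv_succ, ih, pow_succ', mul_assoc (2 * Real.pi * Complex.I)]
    exact funext fun r => (hasDerivAt_realPlaneWave _ r).deriv

theorem iteratedDeriv_two_realPlaneWave (c : ℂ) (r : ℝ) :
    iteratedDeriv 2 (realPlaneWave c) r = -(2 * Real.pi) ^ 2 * realPlaneWave c r := by
  rw [iteratedDeriv_realPlaneWave, ← realPlaneWave_ofReal_mul, mul_pow, Complex.I_sq]
  push_cast
  ring_nf

theorem abs_iteratedDeriv_realPlaneWave_le (k : ℕ) (c : ℂ) (r : ℝ) :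
    |iteratedDeriv k (realPlaneWave c) r| ≤ (2 * Real.pi) ^ k * ‖c‖ := by
  rw [iteratedDeriv_realPlaneWave]
  exact (abs_realPlaneWave_le _ r).trans_eq (by simp [abs_of_pos Real.pi_pos])

theorem contDiff_realPlaneWave (c : ℂ) : ContDiff ℝ ∞ (realPlaneWave c) := by
  refine contDiff_infty.2 fun k => contDiff_of_differentiable_iteratedDeriv fun j _ => ?_
  rw [iteratedDeriv_realPlaneWave]
  exact fun r => (hasDerivAt_realPlaneWave _ r).differentiableAt

end PlaneWaves

section Propagators

/-- The solution `sin (ν t) / ν` of `S'' + ν² S = 0` with `S 0 = 0` and `S' 0 = 1`, written through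
`sinc` so that it is correct at `ν = 0` too. -/
noncomputable def sinePropagator (ν t : ℝ) : ℝ := t * Real.sinc (ν * t)

theorem mul_sinePropagator (ν t : ℝ) : ν * sinePropagator ν t = Real.sin (ν * t) := by
  rcases eq_or_ne (ν * t) 0 with h | h
  · rw [sinePropagator, ← mul_assoc, h, zero_mul, Real.sin_zero]
  · rw [sinePropagator, ← mul_assoc, Real.sinc_of_ne_zero h, mul_div_cancel₀ _ h]

theorem hasDerivAt_sinePropagator (ν t : ℝ) :
    HasDerivAt (sinePropagator ν) (Real.cos (ν * t)) t := by
  rcases eq_or_ne ν 0 with rfl | hν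
  · have identity : sinePropagator 0 = id := funext fun s => by simp [sinePropagator]
    simpa only [identity, zero_mul, Real.cos_zero] using hasDerivAt_id t
  · have sine := (((hasDerivAt_id t).const_mul ν).sin).div_const ν
    refine (sine.congr_of_eventuallyEq (Eventually.of_forall fun s => ?_)).congr_deriv ?_
    · exact eq_div_of_mul_eq hν ((mul_comm _ _).trans (mul_sinePropagator ν s))
    · simp [hν]

theorem iteratedDeriv_cos_const_mul (k : ℕ) (ν t : ℝ) :
    iteratedDeriv k (fun s => Real.cos (ν * s)) t = ν ^ k * iteratedDeriv k Real.cos (ν * t) :=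
  congrFun (iteratedDeriv_comp_const_mul Real.contDiff_cos ν) t

theorem abs_iteratedDeriv_cos_const_mul_le {ν : ℝ} (hν : 0 ≤ ν) (k : ℕ) (t : ℝ) :
    |iteratedDeriv k (fun s => Real.cos (ν * s)) t| ≤ (1 + ν) ^ k := by
  rw [iteratedDeriv_cos_const_mul, abs_mul, abs_of_nonneg (by positivity)]
  calc ν ^ k * |iteratedDeriv k Real.cos (ν * t)| ≤ ν ^ k * 1 := by
        gcongr; exact Real.abs_iteratedDeriv_cos_le_one k _
    _ ≤ (1 + ν) ^ k := by rw [mul_one]; gcongr; linarith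

theorem iteratedDeriv_succ_sinePropagator (k : ℕ) (ν : ℝ) :
    iteratedDeriv (k + 1) (sinePropagator ν) = iteratedDeriv k fun s => Real.cos (ν * s) := by
  rw [iteratedDeriv_succ']
  exact congrArg _ (funext fun t => (hasDerivAt_sinePropagator ν t).deriv)

theorem abs_sinePropagator_le {ν : ℝ} (hν : 0 ≤ ν) (t : ℝ) :
    |sinePropagator ν t| ≤ (1 + |t|) / (1 + ν) := by
  have abs_le : |sinePropagator ν t| ≤ |t| := by
    rw [sinePropagator, abs_mul]
    exact mul_le_of_le_one_right (abs_nonneg t) (Real.abs_sinc_le_one _)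
  have mul_abs_le : ν * |sinePropagator ν t| ≤ 1 := by
    calc ν * |sinePropagator ν t| = |ν * sinePropagator ν t| := by rw [abs_mul, abs_of_nonneg hν]
      _ = |Real.sin (ν * t)| := by rw [mul_sinePropagator]
      _ ≤ 1 := Real.abs_sin_le_one _
  rw [le_div_iff₀ (by positivity)]
  linarith

theorem abs_iteratedDeriv_sinePropagator_le {ν : ℝ} (hν : 0 ≤ ν) (k : ℕ) (t : ℝ) :
    |iteratedDeriv k (sinePropagator ν) t| ≤ (1 + |t|) / (1 + ν) * (1 + ν) ^ k := by
  cases k with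
  | zero => simpa using abs_sinePropagator_le hν t
  | succ k =>
    rw [iteratedDeriv_succ_sinePropagator, pow_succ', ← mul_assoc,
      div_mul_cancel₀ _ (by positivity)]
    refine (abs_iteratedDeriv_cos_const_mul_le hν k t).trans (le_mul_of_one_le_left ?_ ?_)
    · positivity
    · linarith [abs_nonneg t]

theorem contDiff_sinePropagator (ν : ℝ) : ContDiff ℝ ∞ (sinePropagator ν) := by
  refine contDiff_infty_iff_deriv.2
    ⟨fun t => (hasDerivAt_sinePropagator ν t).differentiableAt, ?_⟩
  rw [funext fun t => (hasDerivAt_sinePropagator ν t).deriv]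
  fun_prop

end Propagators

section DerivativeBounds

variable {E : Type*} [NormedAddCommGroup E] [NormedSpace ℝ E] {k : ℕ}

theorem norm_iteratedFDeriv_comp_clm_le {g : ℝ → ℝ} (hg : ContDiff ℝ ∞ g) (ℓ : E →L[ℝ] ℝ) (k : ℕ)
    (p : E) : ‖iteratedFDeriv ℝ k (fun q => g (ℓ q)) p‖ ≤ |iteratedDeriv k g (ℓ p)| * ‖ℓ‖ ^ k := by
  have chain := ℓ.iteratedFDeriv_comp_right (contDiff_infty.1 hg k) p le_rfl
  rw [Function.comp_def] at chain
  rw [chain, ← Real.norm_eq_abs, ← norm_iteratedFDeriv_eq_norm_iteratedDeriv]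
  exact (ContinuousMultilinearMap.norm_compContinuousLinearMap_le _ _).trans_eq (by simp)

theorem norm_iteratedFDeriv_mul_le_of_pow_bounds {f g : E → ℝ} (hf : ContDiff ℝ k f)
    (hg : ContDiff ℝ k g) {p : E} {A B W : ℝ} (hA : ∀ i ≤ k, ‖iteratedFDeriv ℝ i f p‖ ≤ A * W ^ i)
    (hB : ∀ i ≤ k, ‖iteratedFDeriv ℝ i g p‖ ≤ B * W ^ i) :
    ‖iteratedFDeriv ℝ k (fun q => f q * g q) p‖ ≤ A * B * (2 * W) ^ k := by
  calc _ ≤ ∑ i ∈ Finset.range (k + 1), (k.choose i : ℝ) * ‖iteratedFDeriv ℝ i f p‖ *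
          ‖iteratedFDeriv ℝ (k - i) g p‖ := norm_iteratedFDeriv_mul_le hf hg p le_rfl
    _ ≤ ∑ i ∈ Finset.range (k + 1), (k.choose i : ℝ) * (A * B * W ^ k) := by
        refine Finset.sum_le_sum fun i hi => ?_
        have hik : i ≤ k := Finset.mem_range_succ_iff.1 hi
        rw [mul_assoc]
        refine mul_le_mul_of_nonneg_left ?_ (Nat.cast_nonneg _)
        calc _ ≤ (A * W ^ i) * (B * W ^ (k - i)) :=
              mul_le_mul (hA i hik) (hB _ (Nat.sub_le k i)) (norm_nonneg _)
                ((norm_nonneg _).trans (hA i hik))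
          _ = A * B * W ^ k := by rw [mul_mul_mul_comm, ← pow_add, Nat.add_sub_cancel' hik]
    _ = A * B * (2 * W) ^ k := by
        rw [← Finset.sum_mul, ← Nat.cast_sum, Nat.sum_range_choose, mul_pow]
        push_cast
        ring

end DerivativeBounds

theorem laplacian_comp_inner {V : Type*} [NormedAddCommGroup V] [InnerProductSpace ℝ V]
    [FiniteDimensional ℝ V] {g : ℝ → ℝ} (hg : ContDiff ℝ 2 g) (ξ x : V) :
    (Δ fun y => g (inner ℝ ξ y)) x = ‖ξ‖ ^ 2 * iteratedDeriv 2 g (inner ℝ ξ x) := by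
  have second := (innerSL ℝ ξ).iteratedFDeriv_comp_right hg x le_rfl
  simp only [Function.comp_def, innerSL_apply_apply] at second
  rw [laplacian_eq_iteratedFDeriv_stdOrthonormalBasis]
  simp only [second, ContinuousMultilinearMap.compContinuousLinearMap_apply,
    iteratedFDeriv_apply_eq_iteratedDeriv_mul_prod, Fin.prod_univ_two, smul_eq_mul,
    innerSL_apply_apply, Matrix.cons_val_zero, Matrix.cons_val_one]
  rw [← Finset.sum_mul, ← (stdOrthonormalBasis ℝ V).sum_sq_inner_left ξ]
  simp only [sq]

section FourierSynthesis

variable {k : ℕ} {a b : EuclideanSpace ℝ (Fin n) → ℂ}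

/-- One plus the angular frequency `‖2πξ‖` of the plane wave `x ↦ e^{2πi⟪ξ, x⟫}`; its powers measure
the decay of Fourier transforms. -/
noncomputable def frequencyWeight (ξ : EuclideanSpace ℝ (Fin n)) : ℝ := 1 + 2 * Real.pi * ‖ξ‖

/-- The solution of the wave equation with data `x ↦ Re (a e^{2πi⟪ξ, x⟫})` and
`x ↦ Re (b e^{2πi⟪ξ, x⟫})`. -/
noncomputable def waveMode (ξ : EuclideanSpace ℝ (Fin n)) (a b : ℂ)
    (p : EuclideanSpace ℝ (Fin n) × ℝ) : ℝ :=
  Real.cos (2 * Real.pi * ‖ξ‖ * p.2) * realPlaneWave a (inner ℝ ξ p.1) +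
    sinePropagator (2 * Real.pi * ‖ξ‖) p.2 * realPlaneWave b (inner ℝ ξ p.1)

theorem one_le_frequencyWeight (ξ : 𝔼) : 1 ≤ frequencyWeight ξ := by
  rw [frequencyWeight]
  linarith [mul_nonneg Real.two_pi_pos.le (norm_nonneg ξ)]

theorem frequencyWeight_pos (ξ : 𝔼) : 0 < frequencyWeight ξ :=
  zero_lt_one.trans_le (one_le_frequencyWeight ξ)

theorem contDiff_realPlaneWave_inner (ξ : 𝔼) (c : ℂ) :
    ContDiff ℝ ∞ fun p : 𝔼 × ℝ => realPlaneWave c (inner ℝ ξ p.1) :=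
  (contDiff_realPlaneWave c).comp ((innerSL ℝ ξ).contDiff.comp contDiff_fst)

theorem contDiff_comp_time {g : ℝ → ℝ} (hg : ContDiff ℝ ∞ g) :
    ContDiff ℝ ∞ fun p : 𝔼 × ℝ => g p.2 :=
  hg.comp contDiff_snd

theorem contDiff_waveMode (ξ : 𝔼) (a b : ℂ) : ContDiff ℝ ∞ (waveMode ξ a b) :=
  ((contDiff_comp_time (g := fun t => Real.cos (2 * Real.pi * ‖ξ‖ * t)) (by fun_prop)).mul
    (contDiff_realPlaneWave_inner ξ a)).add
    ((contDiff_comp_time (contDiff_sinePropagator _)).mul (contDiff_realPlaneWave_inner ξ b))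

theorem laplacian_waveMode (ξ : 𝔼) (a b : ℂ) (x : 𝔼) (t : ℝ) :
    (Δ fun y => waveMode ξ a b (y, t)) x = -(2 * Real.pi * ‖ξ‖) ^ 2 * waveMode ξ a b (x, t) := by
  have slice : ∀ y, waveMode ξ a b (y, t) =
      realPlaneWave (Real.cos (2 * Real.pi * ‖ξ‖ * t) * a +
        sinePropagator (2 * Real.pi * ‖ξ‖) t * b) (inner ℝ ξ y) := fun y => by
    rw [realPlaneWave_add, realPlaneWave_ofReal_mul, realPlaneWave_ofReal_mul, waveMode]
  simp only [slice]
  rw [laplacian_comp_inner (contDiff_infty.1 (contDiff_realPlaneWave _) 2),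
    iteratedDeriv_two_realPlaneWave]
  ring

theorem hasDerivAt_waveMode_time (ξ : 𝔼) (a b : ℂ) (x : 𝔼) (t : ℝ) :
    HasDerivAt (fun s => waveMode ξ a b (x, s))
      (-(2 * Real.pi * ‖ξ‖) * Real.sin (2 * Real.pi * ‖ξ‖ * t) * realPlaneWave a (inner ℝ ξ x) +
        Real.cos (2 * Real.pi * ‖ξ‖ * t) * realPlaneWave b (inner ℝ ξ x)) t := by
  have cosine := ((hasDerivAt_id t).const_mul (2 * Real.pi * ‖ξ‖)).cos
  have sine := hasDerivAt_sinePropagator (2 * Real.pi * ‖ξ‖) t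
  have superposition := (cosine.mul_const (realPlaneWave a (inner ℝ ξ x))).add
    (sine.mul_const (realPlaneWave b (inner ℝ ξ x)))
  refine superposition.congr_deriv ?_
  simp only [id, mul_one]
  ring

theorem iteratedDeriv_two_waveMode_time (ξ : 𝔼) (a b : ℂ) (x : 𝔼) (t : ℝ) :
    iteratedDeriv 2 (fun s => waveMode ξ a b (x, s)) t =
      -(2 * Real.pi * ‖ξ‖) ^ 2 * waveMode ξ a b (x, t) := by
  rw [iteratedDeriv_succ, iteratedDeriv_one,
    funext fun s => (hasDerivAt_waveMode_time ξ a b x s).deriv]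
  have phase := (hasDerivAt_id t).const_mul (2 * Real.pi * ‖ξ‖)
  refine (((phase.sin.const_mul _).mul_const _).add (phase.cos.mul_const _)).deriv.trans ?_
  simp only [id, mul_one, waveMode]
  linear_combination (2 * Real.pi * ‖ξ‖) * realPlaneWave b (inner ℝ ξ x) *
    mul_sinePropagator (2 * Real.pi * ‖ξ‖) t

theorem waveOperator_waveMode (ξ : 𝔼) (a b : ℂ) (p : 𝔼 × ℝ) :
    waveOperator (waveMode ξ a b) p = 0 := by
  rw [waveOperator, laplacian_waveMode, iteratedDeriv_two_waveMode_time, sub_self]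

theorem norm_iteratedFDeriv_realPlaneWave_inner_le (ξ : 𝔼) (c : ℂ) (k : ℕ) (p : 𝔼 × ℝ) :
    ‖iteratedFDeriv ℝ k (fun q : 𝔼 × ℝ => realPlaneWave c (inner ℝ ξ q.1)) p‖ ≤
      ‖c‖ * frequencyWeight ξ ^ k := by
  have norm_le : ‖(innerSL ℝ ξ).comp (ContinuousLinearMap.fst ℝ 𝔼 ℝ)‖ ≤ ‖ξ‖ :=
    (ContinuousLinearMap.opNorm_comp_le _ _).trans <| by
      rw [innerSL_apply_norm]
      exact mul_le_of_le_one_right (norm_nonneg ξ) (ContinuousLinearMap.norm_fst_le ..)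
  calc _ ≤ |iteratedDeriv k (realPlaneWave c) (inner ℝ ξ p.1)| *
          ‖(innerSL ℝ ξ).comp (ContinuousLinearMap.fst ℝ 𝔼 ℝ)‖ ^ k :=
        norm_iteratedFDeriv_comp_clm_le (contDiff_realPlaneWave c)
          ((innerSL ℝ ξ).comp (ContinuousLinearMap.fst ℝ 𝔼 ℝ)) k p
    _ ≤ (2 * Real.pi) ^ k * ‖c‖ * ‖ξ‖ ^ k := by
        gcongr
        exact abs_iteratedDeriv_realPlaneWave_le k c _
    _ = ‖c‖ * (2 * Real.pi * ‖ξ‖) ^ k := by ring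
    _ ≤ ‖c‖ * frequencyWeight ξ ^ k := by
        gcongr
        exact (lt_one_add _).le

theorem norm_iteratedFDeriv_comp_time_le {g : ℝ → ℝ} (hg : ContDiff ℝ ∞ g) (k : ℕ) (p : 𝔼 × ℝ) :
    ‖iteratedFDeriv ℝ k (fun q : 𝔼 × ℝ => g q.2) p‖ ≤ |iteratedDeriv k g p.2| :=
  (norm_iteratedFDeriv_comp_clm_le hg (ContinuousLinearMap.snd ℝ 𝔼 ℝ) k p).trans <|
    mul_le_of_le_one_right (abs_nonneg _)
      (pow_le_one₀ (norm_nonneg _) (ContinuousLinearMap.norm_snd_le ..))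

theorem norm_iteratedFDeriv_comp_time_mul_realPlaneWave_le {g : ℝ → ℝ} (hg : ContDiff ℝ ∞ g)
    (ξ : 𝔼) (c : ℂ) (k : ℕ) {p : 𝔼 × ℝ} {C : ℝ}
    (hC : ∀ i ≤ k, |iteratedDeriv i g p.2| ≤ C * frequencyWeight ξ ^ i) :
    ‖iteratedFDeriv ℝ k (fun q : 𝔼 × ℝ => g q.2 * realPlaneWave c (inner ℝ ξ q.1)) p‖ ≤
      C * ‖c‖ * (2 * frequencyWeight ξ) ^ k :=
  norm_iteratedFDeriv_mul_le_of_pow_bounds (contDiff_infty.1 (contDiff_comp_time hg) k)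
    (contDiff_infty.1 (contDiff_realPlaneWave_inner ξ c) k)
    (fun i hi => (norm_iteratedFDeriv_comp_time_le hg i p).trans (hC i hi))
    fun i _ => norm_iteratedFDeriv_realPlaneWave_inner_le ξ c i p

theorem norm_iteratedFDeriv_waveMode_le (ξ : 𝔼) (a b : ℂ) (k : ℕ) (p : 𝔼 × ℝ) :
    ‖iteratedFDeriv ℝ k (waveMode ξ a b) p‖ ≤
      (1 + |p.2|) * (‖a‖ + ‖b‖ / frequencyWeight ξ) * (2 * frequencyWeight ξ) ^ k := by
  have frequency_nonneg : 0 ≤ 2 * Real.pi * ‖ξ‖ := by positivity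
  have weight_pos := frequencyWeight_pos ξ
  have cosine_contDiff : ContDiff ℝ ∞ fun t => Real.cos (2 * Real.pi * ‖ξ‖ * t) := by fun_prop
  have sine_contDiff := contDiff_sinePropagator (2 * Real.pi * ‖ξ‖)
  have cosine_term := norm_iteratedFDeriv_comp_time_mul_realPlaneWave_le (p := p) (C := 1)
    cosine_contDiff ξ a k fun i _ =>
      (abs_iteratedDeriv_cos_const_mul_le frequency_nonneg i _).trans_eq (one_mul _).symm
  have sine_term := norm_iteratedFDeriv_comp_time_mul_realPlaneWave_le (p := p) sine_contDiff ξ b k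
    fun i _ => abs_iteratedDeriv_sinePropagator_le frequency_nonneg i _
  have sum_rule := iteratedFDeriv_add_apply (x := p)
    (contDiff_infty.1 ((contDiff_comp_time cosine_contDiff).mul
      (contDiff_realPlaneWave_inner ξ a)) k).contDiffAt
    (contDiff_infty.1 ((contDiff_comp_time sine_contDiff).mul
      (contDiff_realPlaneWave_inner ξ b)) k).contDiffAt
  calc _ ≤ 1 * ‖a‖ * (2 * frequencyWeight ξ) ^ k +
        (1 + |p.2|) / frequencyWeight ξ * ‖b‖ * (2 * frequencyWeight ξ) ^ k :=
        (congrArg norm sum_rule).trans_le (norm_add_le_of_le cosine_term sine_term)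
    _ ≤ (1 + |p.2|) * ‖a‖ * (2 * frequencyWeight ξ) ^ k +
        (1 + |p.2|) / frequencyWeight ξ * ‖b‖ * (2 * frequencyWeight ξ) ^ k := by
        gcongr
        exact le_add_of_nonneg_right (abs_nonneg _)
    _ = _ := by ring

/-- The superposition of wave modes with data the inverse Fourier transforms of `a` and `b`. -/
noncomputable def waveSynthesis (a b : EuclideanSpace ℝ (Fin n) → ℂ)
    (p : EuclideanSpace ℝ (Fin n) × ℝ) : ℝ :=
  ∫ ξ, waveMode ξ (a ξ) (b ξ) p

theorem aestronglyMeasurable_waveMode (ha : AEStronglyMeasurable a) (hb : AEStronglyMeasurable b)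
    (p : 𝔼 × ℝ) : AEStronglyMeasurable fun ξ => waveMode ξ (a ξ) (b ξ) p := by
  have phase : Continuous fun ξ : 𝔼 => (𝐞 (inner ℝ ξ p.1) : ℂ) := by
    fun_prop
  have wave {c : 𝔼 → ℂ} (hc : AEStronglyMeasurable c) :
      AEStronglyMeasurable fun ξ => realPlaneWave (c ξ) (inner ℝ ξ p.1) :=
    Complex.continuous_re.comp_aestronglyMeasurable (phase.aestronglyMeasurable.mul hc)
  have cosine : Continuous fun ξ : 𝔼 => Real.cos (2 * Real.pi * ‖ξ‖ * p.2) := by fun_prop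
  have sine : Continuous fun ξ : 𝔼 => sinePropagator (2 * Real.pi * ‖ξ‖) p.2 :=
    continuous_const.mul (Real.continuous_sinc.comp (by fun_prop))
  exact (cosine.aestronglyMeasurable.mul (wave ha)).add (sine.aestronglyMeasurable.mul (wave hb))

theorem dominatedSmoothFamily_waveMode (ha : AEStronglyMeasurable a) (hb : AEStronglyMeasurable b)
    (ha_int : Integrable fun ξ => frequencyWeight ξ ^ (k + 1) * ‖a ξ‖)
    (hb_int : Integrable fun ξ => frequencyWeight ξ ^ k * ‖b ξ‖) :
    DominatedSmoothFamily volume (k + 1) fun ξ => waveMode ξ (a ξ) (b ξ) where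
  contDiff ξ := contDiff_infty.1 (contDiff_waveMode ξ (a ξ) (b ξ)) _
  aestronglyMeasurable := aestronglyMeasurable_waveMode ha hb
  dominated p₀ := by
    refine ⟨fun ξ => (2 + |p₀.2|) * 2 ^ (k + 1) *
      (frequencyWeight ξ ^ (k + 1) * ‖a ξ‖ + frequencyWeight ξ ^ k * ‖b ξ‖),
      (ha_int.add hb_int).const_mul _, ?_⟩
    have bounded_time : ∀ᶠ p : 𝔼 × ℝ in 𝓝 p₀, |p.2| < 1 + |p₀.2| :=
      (continuous_snd.abs.tendsto p₀).eventually_lt_const (lt_one_add _)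
    filter_upwards [bounded_time] with p hp j hj ξ
    have weight_pos := frequencyWeight_pos ξ
    calc _ ≤ (1 + |p.2|) * (‖a ξ‖ + ‖b ξ‖ / frequencyWeight ξ) * (2 * frequencyWeight ξ) ^ j :=
          norm_iteratedFDeriv_waveMode_le ξ _ _ j p
      _ ≤ (2 + |p₀.2|) * (‖a ξ‖ + ‖b ξ‖ / frequencyWeight ξ) *
          (2 * frequencyWeight ξ) ^ (k + 1) := by
          refine mul_le_mul (mul_le_mul_of_nonneg_right (by linarith) (by positivity))
            (pow_le_pow_right₀ (by linarith [one_le_frequencyWeight ξ]) hj) (by positivity)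
            (by positivity)
      _ = _ := by
          rw [mul_pow, pow_succ (frequencyWeight ξ)]
          field_simp

theorem waveOperator_waveSynthesis (hk : 1 ≤ k) (h : DominatedSmoothFamily volume (k + 1)
    fun ξ => waveMode ξ (a ξ) (b ξ)) (p : 𝔼 × ℝ) : waveOperator (waveSynthesis a b) p = 0 := by
  have two_le : 2 ≤ k + 1 := Nat.succ_le_succ hk
  have smooth : ContDiff ℝ 2 (waveSynthesis a b) :=
    h.contDiff_integral.of_le (by exact_mod_cast two_le)
  have trace := h.clm_iteratedFDeriv_integral two_le (minkowskiTrace n) p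
  rw [waveOperator_eq_minkowskiTrace smooth]
  refine trace.trans (integral_eq_zero_of_ae (Eventually.of_forall fun ξ => ?_))
  dsimp only [Pi.zero_apply]
  rw [← waveOperator_eq_minkowskiTrace (contDiff_infty.1 (contDiff_waveMode ξ _ _) 2),
    waveOperator_waveMode]

theorem integral_realPlaneWave {c : 𝔼 → ℂ} (hc : Integrable c) (x : 𝔼) :
    ∫ ξ, realPlaneWave (c ξ) (inner ℝ ξ x) = (𝓕⁻ c x).re := by
  have integrable : Integrable fun ξ => 𝐞 (inner ℝ ξ x) • c ξ := by
    simpa only [inner_neg_right, neg_neg] using (Real.fourierIntegral_convergent_iff (-x)).2 hc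
  rw [Real.fourierInv_eq]
  exact integral_re integrable

theorem waveSynthesis_zero_right (ha : Integrable a) (x : 𝔼) :
    waveSynthesis a b (x, 0) = (𝓕⁻ a x).re := by
  simp [waveSynthesis, waveMode, sinePropagator, integral_realPlaneWave ha]

theorem deriv_waveSynthesis_zero_right (hb : Integrable b) (h : DominatedSmoothFamily volume (k + 1)
    fun ξ => waveMode ξ (a ξ) (b ξ)) (x : 𝔼) :
    deriv (fun t => waveSynthesis a b (x, t)) 0 = (𝓕⁻ b x).re := by
  have smooth : Differentiable ℝ (waveSynthesis a b) :=
    h.contDiff_integral.differentiable (by simp)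
  have mode_velocity (ξ : 𝔼) : fderiv ℝ (waveMode ξ (a ξ) (b ξ)) (x, 0) (0, 1) =
      realPlaneWave (b ξ) (inner ℝ ξ x) := by
    have differentiable := (contDiff_waveMode ξ (a ξ) (b ξ)).differentiable (by simp)
    rw [← (hasDerivAt_comp_prodMk_right differentiable x 0).deriv,
      (hasDerivAt_waveMode_time ξ (a ξ) (b ξ) x 0).deriv]
    simp
  rw [(hasDerivAt_comp_prodMk_right smooth x 0).deriv, ← integral_realPlaneWave hb]
  exact (h.fderiv_integral_apply (Nat.le_add_left 1 k) (x, 0) (0, 1)).trans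
    (integral_congr_ae (Eventually.of_forall mode_velocity))

end FourierSynthesis

section FourierTransformOfIntegrable

open scoped SchwartzMap

variable {E F : Type*} [NormedAddCommGroup E] [InnerProductSpace ℝ E] [FiniteDimensional ℝ E]
  [MeasurableSpace E] [BorelSpace E] [NormedAddCommGroup F] [NormedSpace ℂ F] {f : E → F}

theorem continuous_fourier_of_integrable (hf : Integrable f) : Continuous (𝓕 f) :=
  VectorFourier.fourierIntegral_continuous Real.continuous_fourierChar
    (innerSL ℝ).continuous₂ hf

theorem continuous_fourierInv_of_integrable (hf : Integrable f) : Continuous (𝓕⁻ f) := by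
  rw [Real.fourierInv_eq_fourier_comp_neg]
  exact continuous_fourier_of_integrable hf.comp_neg

variable [CompleteSpace F]

theorem ae_eq_of_integral_schwartzMap_smul_eq {f g : E → F}
    (hf : LocallyIntegrable f) (hg : LocallyIntegrable g)
    (h : ∀ φ : 𝓢(E, ℂ), ∫ x, φ x • f x = ∫ x, φ x • g x) : f =ᵐ[volume] g := by
  refine ae_eq_of_integral_contDiff_smul_eq hf hg fun φ hφ hc => ?_
  have smooth : ContDiff ℝ ∞ (Complex.ofRealCLM ∘ φ) := by fun_prop
  have compact : HasCompactSupport (Complex.ofRealCLM ∘ φ) := hc.comp_left rfl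
  exact h (compact.toSchwartzMap smooth)

theorem integral_fourier_smul_of_integrable {φ : E → ℂ} (hφ : Integrable φ) (hf : Integrable f) :
    ∫ ξ, 𝓕 φ ξ • f ξ = ∫ x, φ x • 𝓕 f x := by
  simpa using! VectorFourier.integral_fourierIntegral_smul_eq_flip (L := innerₗ E)
    Real.continuous_fourierChar continuous_inner hφ hf

theorem integral_fourierInv_smul_of_integrable {φ : E → ℂ} (hφ : Integrable φ)
    (hf : Integrable f) : ∫ ξ, 𝓕⁻ φ ξ • f ξ = ∫ x, φ x • 𝓕⁻ f x := by
  rw [Real.fourierInv_eq_fourier_comp_neg, integral_fourier_smul_of_integrable hφ.comp_neg hf,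
    ← integral_neg_eq_self]
  simp only [neg_neg, Real.fourierInv_eq_fourier_neg]

theorem fourierInv_fourier_ae_eq (hf : Integrable f) (hf' : Integrable (𝓕 f)) :
    𝓕⁻ (𝓕 f) =ᵐ[volume] f := by
  refine ae_eq_of_integral_schwartzMap_smul_eq
    (continuous_fourierInv_of_integrable hf').locallyIntegrable hf.locallyIntegrable fun φ => ?_
  calc ∫ x, φ x • 𝓕⁻ (𝓕 f) x = ∫ ξ, (𝓕⁻ φ) ξ • 𝓕 f ξ := by
        rw [← integral_fourierInv_smul_of_integrable φ.integrable hf', SchwartzMap.fourierInv_coe]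
    _ = ∫ x, 𝓕 (𝓕⁻ φ) x • f x := by
        rw [← integral_fourier_smul_of_integrable (𝓕⁻ φ).integrable hf, SchwartzMap.fourier_coe]
    _ = ∫ x, φ x • f x := by rw [FourierTransform.fourier_fourierInv_eq]

theorem memLp_two_fourier {H : Type*} [NormedAddCommGroup H] [InnerProductSpace ℂ H]
    [CompleteSpace H] {f : E → H} (hf : Integrable f) (hf₂ : MemLp f 2) : MemLp (𝓕 f) 2 := by
  have memLp := Lp.memLp (𝓕 (hf₂.toLp f))
  refine memLp.ae_eq (ae_eq_of_integral_schwartzMap_smul_eq (memLp.locallyIntegrable (by norm_num))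
    (continuous_fourier_of_integrable hf).locallyIntegrable fun φ => ?_)
  have distributional : ∫ x, 𝓕 φ x • (hf₂.toLp f) x = ∫ ξ, φ ξ • 𝓕 (hf₂.toLp f) ξ := by
    simpa only [TemperedDistribution.fourier_apply, Lp.toTemperedDistribution_apply] using
      congrArg (fun T => T φ) (Lp.fourier_toTemperedDistribution_eq (hf₂.toLp f))
  rw [← distributional, ← integral_fourier_smul_of_integrable φ.integrable hf]
  refine integral_congr_ae ?_
  filter_upwards [hf₂.coeFn_toLp] with x hx
  rw [hx, SchwartzMap.fourier_coe]

end FourierTransformOfIntegrable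

section LocalRegularity

variable {s : ℝ} {f g φ : EuclideanSpace ℝ (Fin n) → ℝ} {F : Type*} [NormedAddCommGroup F]
  [NormedSpace ℝ F] {χ : EuclideanSpace ℝ (Fin n) → F}

theorem exists_smooth_cutoff (R : ℝ) : ∃ ψ : 𝔼 → ℂ, ContDiff ℝ ∞ ψ ∧ HasCompactSupport ψ ∧
    ∀ x ∈ Metric.ball 0 R, ψ x = 1 := by
  let φ : ContDiffBump (0 : 𝔼) := ⟨max R 1, max R 1 + 1, by positivity, lt_add_one _⟩
  refine ⟨Complex.ofRealCLM ∘ φ, Complex.ofRealCLM.contDiff.comp φ.contDiff,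
    φ.hasCompactSupport.comp_left rfl, fun x hx => ?_⟩
  have eq_one := φ.one_of_mem_closedBall
    (Metric.ball_subset_closedBall (Metric.ball_subset_ball (le_max_left R 1) hx))
  simp [eq_one]

theorem memLp_smul_of_hasCompactSupport (hf : SquareIntegrableOnBounded f) (hχ : Continuous χ)
    (hc : HasCompactSupport χ) : MemLp (fun x => f x • χ x) 2 := by
  have memLp_tsupport := hf _ hc.isCompact.isBounded
  obtain ⟨C, hC⟩ := hχ.bounded_above_of_compact_support hc
  have product : MemLp (fun x => f x • χ x) 2 (volume.restrict (tsupport χ)) :=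
    memLp_tsupport.of_le_mul (memLp_tsupport.1.smul hχ.aestronglyMeasurable) <|
      Eventually.of_forall fun x => by
        rw [norm_smul, mul_comm]
        gcongr
        exact hC x
  have supported : (tsupport χ).indicator (fun x => f x • χ x) = fun x => f x • χ x :=
    indicator_eq_self.2 ((Function.support_smul_subset_right f χ).trans (subset_tsupport χ))
  exact supported ▸ (memLp_indicator_iff_restrict (isClosed_tsupport χ).measurableSet).2 product

theorem integrable_smul_of_hasCompactSupport (hf : SquareIntegrableOnBounded f)
    (hχ : Continuous χ) (hc : HasCompactSupport χ) : Integrable fun x => f x • χ x := by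
  have : IsFiniteMeasure (volume.restrict (tsupport χ)) :=
    isFiniteMeasure_restrict.2 hc.isCompact.measure_lt_top.ne
  refine (integrableOn_iff_integrable_of_support_subset ?_).1
    (((memLp_smul_of_hasCompactSupport hf hχ hc).restrict (tsupport χ)).integrable one_le_two)
  exact (Function.support_smul_subset_right f χ).trans (subset_tsupport χ)

theorem contDiff_partialDerivative {k : ℕ} (hφ : ContDiff ℝ ∞ φ) (i : Fin k → Fin n) :
    ContDiff ℝ ∞ (partialDerivative i φ) :=
  (ContinuousMultilinearMap.apply ℝ (fun _ : Fin k => 𝔼) ℝ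
    fun l => EuclideanSpace.single (i l) (1 : ℝ)).contDiff.comp
    (hφ.iteratedFDeriv_right (m := ∞) (by exact_mod_cast le_rfl))

theorem hasCompactSupport_partialDerivative {k : ℕ} (hφ : HasCompactSupport φ)
    (i : Fin k → Fin n) : HasCompactSupport (partialDerivative i φ) :=
  (hφ.iteratedFDeriv (𝕜 := ℝ) k).comp_left
    (g := fun L : ContinuousMultilinearMap ℝ (fun _ : Fin k => 𝔼) ℝ =>
      L fun l => EuclideanSpace.single (i l) (1 : ℝ)) rfl

theorem partialDerivative_one (j : Fin n) (φ : 𝔼 → ℝ) :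
    partialDerivative (fun _ : Fin 1 => j) φ =
      fun x => fderiv ℝ φ x (EuclideanSpace.single j 1) :=
  funext fun _ => iteratedFDeriv_one_apply _

theorem partialDerivative_cons {k : ℕ} (hφ : ContDiff ℝ ∞ φ) (j : Fin n) (i : Fin k → Fin n) :
    partialDerivative (Fin.cons j i : Fin (k + 1) → Fin n) φ =
      partialDerivative (fun _ : Fin 1 => j) (partialDerivative i φ) := by
  funext x
  have differentiable : DifferentiableAt ℝ (iteratedFDeriv ℝ k φ) x :=
    hφ.differentiable_iteratedFDeriv (by exact_mod_cast WithTop.coe_lt_top _) x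
  have chain_rule := ((ContinuousMultilinearMap.apply ℝ (fun _ : Fin k => 𝔼) ℝ
    fun l => EuclideanSpace.single (i l) (1 : ℝ)).hasFDerivAt.comp x
      differentiable.hasFDerivAt).fderiv
  rw [partialDerivative_one]
  refine (iteratedFDeriv_succ_apply_left _).trans ?_
  exact (DFunLike.congr_fun chain_rule (EuclideanSpace.single j 1)).symm

theorem IsGeneralizedDerivative.of_cons {k : ℕ} {j : Fin n} {i : Fin k → Fin n} {h : 𝔼 → ℝ}
    (hfg : IsGeneralizedDerivative (fun _ : Fin 1 => j) f g)
    (hfh : IsGeneralizedDerivative (Fin.cons j i : Fin (k + 1) → Fin n) f h) :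
    IsGeneralizedDerivative i g h := by
  intro φ hφ hc
  have first := hfg _ (contDiff_partialDerivative hφ i) (hasCompactSupport_partialDerivative hc i)
  rw [← partialDerivative_cons hφ, hfh φ hφ hc] at first
  linear_combination first

theorem HasSquareIntegrableDerivativesUpTo.mono {r : ℝ}
    (hf : HasSquareIntegrableDerivativesUpTo s f) (hr : r ≤ s) :
    HasSquareIntegrableDerivativesUpTo r f :=
  ⟨hf.1, fun k hk => hf.2 k (hk.trans hr)⟩

theorem HasSquareIntegrableDerivativesUpTo.exists_derivative (hs : 0 ≤ s)
    (hf : HasSquareIntegrableDerivativesUpTo (s + 1) f) (j : Fin n) :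
    ∃ g, HasSquareIntegrableDerivativesUpTo s g ∧
      IsGeneralizedDerivative (fun _ : Fin 1 => j) f g := by
  obtain ⟨g, hg, hfg⟩ := hf.2 1 (by simpa using hs) fun _ => j
  refine ⟨g, ⟨hg, fun k hk i => ?_⟩, hfg⟩
  obtain ⟨h, hh, hfh⟩ := hf.2 (k + 1) (by simpa using hk) (Fin.cons j i)
  exact ⟨h, hh, hfg.of_cons hfh⟩

theorem IsGeneralizedDerivative.integral_smul_fderiv [CompleteSpace F] {j : Fin n}
    (hfg : IsGeneralizedDerivative (fun _ : Fin 1 => j) f g) (hf : SquareIntegrableOnBounded f)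
    (hg : SquareIntegrableOnBounded g) (hχ : ContDiff ℝ ∞ χ) (hc : HasCompactSupport χ) :
    ∫ x, f x • fderiv ℝ χ x (EuclideanSpace.single j 1) = -∫ x, g x • χ x := by
  have left_integrable := integrable_smul_of_hasCompactSupport hf
    (contDiff_fderiv_apply_const (k := ∞) hχ (EuclideanSpace.single j 1)).continuous
      (hc.fderiv_apply ℝ _)
  have right_integrable := integrable_smul_of_hasCompactSupport hg hχ.continuous hc
  refine (SeparatingDual.eq_iff_forall_dual_eq (R := ℝ)).2 fun L => ?_
  have scalar := hfg (L ∘ χ) (L.contDiff.comp hχ) (hc.comp_left L.map_zero)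
  have chain_rule (x : 𝔼) : fderiv ℝ (L ∘ χ) x = L.comp (fderiv ℝ χ x) :=
    (L.hasFDerivAt.comp x (hχ.differentiable (by simp) x).hasFDerivAt).fderiv
  rw [map_neg, ← L.integral_comp_comm left_integrable, ← L.integral_comp_comm right_integrable]
  simpa [partialDerivative_one, chain_rule] using scalar

end LocalRegularity

section LocalizedFourierTransform

variable {k m : ℕ} {f g : EuclideanSpace ℝ (Fin n) → ℝ} {ψ : EuclideanSpace ℝ (Fin n) → ℂ}

/-- The Fourier transform of `f` cut off by the test function `ψ`. -/
noncomputable def localizedFourier (ψ : EuclideanSpace ℝ (Fin n) → ℂ)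
    (f : EuclideanSpace ℝ (Fin n) → ℝ) : EuclideanSpace ℝ (Fin n) → ℂ :=
  𝓕 fun x => f x • ψ x

theorem continuous_localizedFourier (hf : SquareIntegrableOnBounded f) (hψ : Continuous ψ)
    (hc : HasCompactSupport ψ) : Continuous (localizedFourier ψ f) :=
  continuous_fourier_of_integrable (integrable_smul_of_hasCompactSupport hf hψ hc)

theorem contDiff_fourierChar_neg_inner (ξ : 𝔼) :
    ContDiff ℝ ∞ fun x : 𝔼 => (𝐞 (-inner ℝ x ξ) : ℂ) := by
  simp only [Real.fourierChar_apply]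
  have phase : ContDiff ℝ ∞ fun x : 𝔼 => 2 * Real.pi * -inner ℝ x ξ :=
    contDiff_const.mul (contDiff_id.inner ℝ contDiff_const).neg
  exact ((Complex.ofRealCLM.contDiff.comp phase).mul contDiff_const).cexp

theorem fderiv_fourierChar_neg_inner_mul_single (hψ : Differentiable ℝ ψ) (j : Fin n) (x ξ : 𝔼) :
    fderiv ℝ (fun y => 𝐞 (-inner ℝ y ξ) * ψ y) x (EuclideanSpace.single j 1) =
      𝐞 (-inner ℝ x ξ) * fderiv ℝ ψ x (EuclideanSpace.single j 1) -
        2 * Real.pi * Complex.I * ξ j * (𝐞 (-inner ℝ x ξ) * ψ x) := by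
  have character : fderiv ℝ (fun y : 𝔼 => (𝐞 (-inner ℝ y ξ) : ℂ)) x (EuclideanSpace.single j 1) =
      -2 * Real.pi * Complex.I * inner ℝ (EuclideanSpace.single j (1 : ℝ)) ξ *
        𝐞 (-inner ℝ x ξ) :=
    Real.fderiv_fourierChar_neg_bilinear_left_apply (innerSL ℝ) x (EuclideanSpace.single j 1) ξ
  rw [fderiv_fun_mul ((contDiff_fourierChar_neg_inner ξ).differentiable (by simp) x) (hψ x)]
  simp only [add_apply, smul_apply, smul_eq_mul, character, EuclideanSpace.inner_single_left,
    map_one, one_mul]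
  ring

theorem IsGeneralizedDerivative.localizedFourier_eq {j : Fin n}
    (hfg : IsGeneralizedDerivative (fun _ : Fin 1 => j) f g) (hf : SquareIntegrableOnBounded f)
    (hg : SquareIntegrableOnBounded g) (hψ : ContDiff ℝ ∞ ψ) (hc : HasCompactSupport ψ) (ξ : 𝔼) :
    2 * Real.pi * Complex.I * ξ j * localizedFourier ψ f ξ =
      localizedFourier (fun x => fderiv ℝ ψ x (EuclideanSpace.single j 1)) f ξ +
        localizedFourier ψ g ξ := by
  have integrable {χ : 𝔼 → ℂ} (hχ : Continuous χ) (hc : HasCompactSupport χ) :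
      Integrable fun x => 𝐞 (-inner ℝ x ξ) • f x • χ x :=
    (Real.fourierIntegral_convergent_iff ξ).2 (integrable_smul_of_hasCompactSupport hf hχ hc)
  have by_parts := hfg.integral_smul_fderiv hf hg (χ := fun x => 𝐞 (-inner ℝ x ξ) * ψ x)
    ((contDiff_fourierChar_neg_inner ξ).mul hψ) hc.mul_left
  have left_eq : ∫ x, f x • fderiv ℝ (fun y => 𝐞 (-inner ℝ y ξ) * ψ y) x
      (EuclideanSpace.single j 1) =
      localizedFourier (fun x => fderiv ℝ ψ x (EuclideanSpace.single j 1)) f ξ -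
        2 * Real.pi * Complex.I * ξ j * localizedFourier ψ f ξ := by
    simp only [localizedFourier, Real.fourier_eq]
    rw [← integral_const_mul,
      ← integral_sub (integrable (contDiff_fderiv_apply_const (k := ∞) hψ _).continuous
      (hc.fderiv_apply ℝ _)) ((integrable hψ.continuous hc).const_mul _)]
    refine integral_congr_ae (Eventually.of_forall fun x => ?_)
    dsimp only
    rw [fderiv_fourierChar_neg_inner_mul_single (hψ.differentiable (by simp))]
    simp only [Circle.smul_def, smul_eq_mul, Complex.real_smul]
    ring
  have right_eq : ∫ x, g x • (𝐞 (-inner ℝ x ξ) * ψ x) = localizedFourier ψ g ξ := by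
    simp only [localizedFourier, Real.fourier_eq, Circle.smul_def, smul_eq_mul, mul_smul_comm]
  rw [left_eq, right_eq] at by_parts
  linear_combination -by_parts

theorem frequencyWeight_le_one_add_sum (ξ : 𝔼) :
    frequencyWeight ξ ≤ 1 + ∑ j, 2 * Real.pi * |ξ j| := by
  have norm_le : ‖ξ‖ ≤ ∑ j, |ξ j| := by
    conv_lhs => rw [← (EuclideanSpace.basisFun (Fin n) ℝ).sum_repr ξ]
    refine (norm_sum_le _ _).trans_eq (Finset.sum_congr rfl fun j _ => ?_)
    simp [norm_smul]
  rw [frequencyWeight, ← Finset.mul_sum]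
  gcongr

theorem continuous_frequencyWeight : Continuous (frequencyWeight (n := n)) := by
  unfold frequencyWeight
  fun_prop

theorem frequencyWeight_mul_norm_localizedFourier_le {g : Fin n → 𝔼 → ℝ}
    (hfg : ∀ j, IsGeneralizedDerivative (fun _ : Fin 1 => j) f (g j))
    (hf : SquareIntegrableOnBounded f) (hg : ∀ j, SquareIntegrableOnBounded (g j))
    (hψ : ContDiff ℝ ∞ ψ) (hc : HasCompactSupport ψ) (ξ : 𝔼) :
    frequencyWeight ξ * ‖localizedFourier ψ f ξ‖ ≤ ‖localizedFourier ψ f ξ‖ +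
      ∑ j, (‖localizedFourier (fun x => fderiv ℝ ψ x (EuclideanSpace.single j 1)) f ξ‖ +
        ‖localizedFourier ψ (g j) ξ‖) := by
  have derivative_eq (j : Fin n) : 2 * Real.pi * |ξ j| * ‖localizedFourier ψ f ξ‖ =
      ‖localizedFourier (fun x => fderiv ℝ ψ x (EuclideanSpace.single j 1)) f ξ +
        localizedFourier ψ (g j) ξ‖ := by
    rw [← (hfg j).localizedFourier_eq hf (hg j) hψ hc]
    simp [abs_of_pos Real.pi_pos]
  calc _ ≤ (1 + ∑ j, 2 * Real.pi * |ξ j|) * ‖localizedFourier ψ f ξ‖ := by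
        gcongr
        exact frequencyWeight_le_one_add_sum ξ
    _ = ‖localizedFourier ψ f ξ‖ + ∑ j, 2 * Real.pi * |ξ j| * ‖localizedFourier ψ f ξ‖ := by
        rw [add_mul, one_mul, Finset.sum_mul]
    _ ≤ _ := by
        gcongr with j
        exact (derivative_eq j).trans_le (norm_add_le _ _)

theorem HasSquareIntegrableDerivativesUpTo.memLp_frequencyWeight_pow_mul_localizedFourier
    (hf : HasSquareIntegrableDerivativesUpTo (k : ℝ) f) (hψ : ContDiff ℝ ∞ ψ)
    (hc : HasCompactSupport ψ) :
    MemLp (fun ξ => frequencyWeight ξ ^ k * ‖localizedFourier ψ f ξ‖) 2 := by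
  induction k generalizing f ψ with
  | zero =>
    simpa only [pow_zero, one_mul, localizedFourier] using
      (memLp_two_fourier (integrable_smul_of_hasCompactSupport hf.1 hψ.continuous hc)
        (memLp_smul_of_hasCompactSupport hf.1 hψ.continuous hc)).norm
  | succ k ih =>
    rw [Nat.cast_succ] at hf
    choose g hg hfg using hf.exists_derivative k.cast_nonneg
    have hf' := hf.mono (lt_add_one (k : ℝ)).le
    have memLp_derivatives := memLp_finsetSum Finset.univ fun j _ =>
      (ih hf' (contDiff_fderiv_apply_const (k := ∞) hψ (EuclideanSpace.single j 1))
        (hc.fderiv_apply ℝ _)).add (ih (hg j) hψ hc)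
    refine ((ih hf' hψ hc).add memLp_derivatives).mono' ?_ (Eventually.of_forall fun ξ => ?_)
    · exact ((continuous_frequencyWeight.pow _).mul
        (continuous_localizedFourier hf.1 hψ.continuous hc).norm).aestronglyMeasurable
    have weight_nonneg := (frequencyWeight_pos ξ).le
    rw [Real.norm_of_nonneg (by positivity), pow_succ, mul_assoc]
    simp only [Pi.add_apply, ← mul_add, ← Finset.mul_sum]
    gcongr
    exact frequencyWeight_mul_norm_localizedFourier_le hfg hf.1 (fun j => (hg j).1) hψ hc ξ

theorem memLp_inv_frequencyWeight_pow (hk : n < 2 * k) :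
    MemLp (fun ξ : 𝔼 => (frequencyWeight ξ ^ k)⁻¹) 2 := by
  have continuous_inv : Continuous fun ξ : 𝔼 => (frequencyWeight ξ ^ k)⁻¹ :=
    (continuous_frequencyWeight.pow k).inv₀ fun ξ => (pow_pos (frequencyWeight_pos ξ) k).ne'
  rw [memLp_two_iff_integrable_sq continuous_inv.aestronglyMeasurable]
  have integrable := integrable_one_add_norm (E := 𝔼) (μ := volume) (r := ((2 * k : ℕ) : ℝ))
    (by rw [finrank_euclideanSpace_fin]; exact_mod_cast hk)
  refine integrable.mono' (continuous_inv.pow 2).aestronglyMeasurable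
    (Eventually.of_forall fun ξ => ?_)
  rw [Real.norm_of_nonneg (sq_nonneg _), Real.rpow_neg (by positivity), Real.rpow_natCast, inv_pow,
    ← pow_mul, mul_comm k, frequencyWeight]
  gcongr
  exact le_mul_of_one_le_left (norm_nonneg ξ) (by linarith [Real.pi_gt_three])

theorem HasSquareIntegrableDerivativesUpTo.integrable_frequencyWeight_pow_mul_localizedFourier
    (hf : HasSquareIntegrableDerivativesUpTo ((n : ℝ) / 2 + 1 + m) f) (hψ : ContDiff ℝ ∞ ψ)
    (hc : HasCompactSupport ψ) :
    Integrable fun ξ => frequencyWeight ξ ^ m * ‖localizedFourier ψ f ξ‖ := by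
  have order_le : ((n / 2 + 1 + m : ℕ) : ℝ) ≤ (n : ℝ) / 2 + 1 + m := by
    push_cast
    gcongr
    exact Nat.cast_div_le
  have memLp := (hf.mono order_le).memLp_frequencyWeight_pow_mul_localizedFourier hψ hc
  have summable_weight : MemLp (fun ξ : 𝔼 => (frequencyWeight ξ ^ (n / 2 + 1))⁻¹) 2 :=
    memLp_inv_frequencyWeight_pow (by lia)
  refine (memLp.integrable_mul summable_weight).congr (Eventually.of_forall fun ξ => ?_)
  have weight_pos := frequencyWeight_pos ξ
  simp only [Pi.mul_apply, pow_add]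
  field_simp

theorem integrable_of_frequencyWeight_pow_mul {a : 𝔼 → ℂ} (ha : Continuous a)
    (h : Integrable fun ξ => frequencyWeight ξ ^ m * ‖a ξ‖) : Integrable a :=
  h.mono' ha.aestronglyMeasurable <| Eventually.of_forall fun ξ =>
    le_mul_of_one_le_left (norm_nonneg _) (one_le_pow₀ (one_le_frequencyWeight ξ))

theorem fourierInv_localizedFourier_ae_eq (hf : SquareIntegrableOnBounded f) (hψ : Continuous ψ)
    (hc : HasCompactSupport ψ) (h : Integrable (localizedFourier ψ f)) :
    𝓕⁻ (localizedFourier ψ f) =ᵐ[volume] fun x => f x • ψ x :=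
  fourierInv_fourier_ae_eq (integrable_smul_of_hasCompactSupport hf hψ hc) h

end LocalizedFourierTransform

theorem exists_solvesCauchyProblem_ball {m : ℕ} (hm : 2 ≤ m) {u₀ u₁ : 𝔼 → ℝ}
    (h₀ : HasSquareIntegrableDerivativesUpTo ((n : ℝ) / 2 + 1 + m) u₀)
    (h₁ : HasSquareIntegrableDerivativesUpTo ((n : ℝ) / 2 + m) u₁) (R : ℝ) :
    ∃ u, SolvesCauchyProblem m (Metric.ball 0 R) u₀ u₁ u := by
  obtain ⟨k, rfl⟩ := Nat.exists_eq_add_of_le' (one_le_two.trans hm)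
  replace h₁ : HasSquareIntegrableDerivativesUpTo ((n : ℝ) / 2 + 1 + k) u₁ :=
    h₁.mono (le_of_eq (by push_cast; ring))
  obtain ⟨ψ, hψ, hc, ψ_eq_one⟩ := exists_smooth_cutoff (n := n) R
  have continuous₀ := continuous_localizedFourier h₀.1 hψ.continuous hc
  have continuous₁ := continuous_localizedFourier h₁.1 hψ.continuous hc
  have integrable₀ := h₀.integrable_frequencyWeight_pow_mul_localizedFourier hψ hc
  have integrable₁ := h₁.integrable_frequencyWeight_pow_mul_localizedFourier hψ hc
  have modes := dominatedSmoothFamily_waveMode continuous₀.aestronglyMeasurable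
    continuous₁.aestronglyMeasurable integrable₀ integrable₁
  have spectrum₀ := integrable_of_frequencyWeight_pow_mul continuous₀ integrable₀
  have spectrum₁ := integrable_of_frequencyWeight_pow_mul continuous₁ integrable₁
  refine ⟨waveSynthesis (localizedFourier ψ u₀) (localizedFourier ψ u₁), modes.contDiff_integral,
    waveOperator_waveSynthesis (Nat.le_of_succ_le_succ hm) modes, ?_, ?_⟩
  · filter_upwards [ae_restrict_of_ae (fourierInv_localizedFourier_ae_eq h₀.1 hψ.continuous hc
      spectrum₀), ae_restrict_mem measurableSet_ball] with x inversion hx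
    rw [waveSynthesis_zero_right spectrum₀, inversion, ψ_eq_one x hx]
    simp
  · filter_upwards [ae_restrict_of_ae (fourierInv_localizedFourier_ae_eq h₁.1 hψ.continuous hc
      spectrum₁), ae_restrict_mem measurableSet_ball] with x inversion hx
    rw [deriv_waveSynthesis_zero_right spectrum₁ modes, inversion, ψ_eq_one x hx]
    simp

theorem mainTheorem10_general (n m : ℕ) (hm : 2 ≤ m) (u₀ u₁ : EuclideanSpace ℝ (Fin n) → ℝ)
    (h₀ : HasSquareIntegrableDerivativesUpTo ((n : ℝ) / 2 + 1 + m) u₀)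
    (h₁ : HasSquareIntegrableDerivativesUpTo ((n : ℝ) / 2 + m) u₁) :
    ∃ u : EuclideanSpace ℝ (Fin n) × ℝ → ℝ,
      ContDiff ℝ m u ∧
      (∀ p, waveOperator u p = 0) ∧
      (fun x => u (x, 0)) =ᵐ[volume] u₀ ∧
      (fun x => deriv (fun t => u (x, t)) 0) =ᵐ[volume] u₁ := by
  obtain ⟨u, hu⟩ :=
    exists_solvesCauchyProblem_univ hm (exists_solvesCauchyProblem_ball hm h₀ h₁)
  rw [← volume.restrict_univ]
  exact ⟨u, hu.contDiff, hu.wave, hu.position, hu.velocity⟩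

theorem mainTheorem10 (n : ℕ) (u₀ u₁ : EuclideanSpace ℝ (Fin n) → ℝ)
    (h₀ : HasSquareIntegrableDerivativesUpTo ((n : ℝ) / 2 + 3) u₀)
    (h₁ : HasSquareIntegrableDerivativesUpTo ((n : ℝ) / 2 + 2) u₁) :
    ∃ u : EuclideanSpace ℝ (Fin n) × ℝ → ℝ,
      ContDiff ℝ 2 u ∧
      (∀ p, waveOperator u p = 0) ∧
      (fun x => u (x, 0)) =ᵐ[volume] u₀ ∧
      (fun x => deriv (fun t => u (x, t)) 0) =ᵐ[volume] u₁ :=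
  mainTheorem10_general n 2 le_rfl u₀ u₁ (h₀.mono (by norm_num [add_assoc]))
    (h₁.mono (by norm_num))
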